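/- Let $p$ be a prime and let $A$ be a commutative ring which is $p$-normal, i.e. $p$-torsion-free and integrally closed in $R := A[1/p]$. Equip $R$ with the $p$-adic seminorm: $|x|$ is the infimum of $p^{-c/d}$ over all $c,d\in\mathbb{Z}$ with $d>0$ and $p^{-c}x^d\in A$. For $n\ge 0$ let $W_{p^n}(R)$ be the ring of $p$-typical Witt vectors $(x_1,x_p,\dots,x_{p^n})$ of length $n+1$, with $|(x_{p^i})_{0\le i\le n}|_W := \max_i |x_{p^i}|^{1/p^i}$, and let $\overleftarrow{W}(R)$ be the inverse limit of the rings $W_{p^n}(R)$ along the Witt vector Frobenius maps $F: W_{p^{n+1}}(R)\to W_{p^n}(R)$. For real $b>0$ let $\overleftarrow{W}^b(R)$ be the set of $\underline{x}=(\underline{x}_{p^{-n}})_{n\ge 0}\in\overleftarrow{W}(R)$ with $p^{-bn}|\underline{x}_{p^{-n}}|_W^{p^n}\to 0$ as $n\to\infty$, and put $|\underline{x}|_{W,b} := \sup_n p^{-bn}|\underline{x}_{p^{-n}}|_W^{p^n}$ for such $\underline{x}$. Call a function $f$ from a commutative ring to $[0,\infty)$ a power-multiplicative seminorm if $f(0)=0$,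 $f(x+y)\le\max\{f(x),f(y)\}$, $f(xy)\le f(x)f(y)$ and $f(x^2)\ge f(x)^2$ for all $x,y$. Call $f,g$ equivalent if $f\le c_1 g$ and $g\le c_2 f$ for some constants $c_1,c_2>0$. Theorem. For every $b>0$, the subset $\overleftarrow{W}^b(R)$ is a subring of $\overleftarrow{W}(R)$, and $|\cdot|_{W,b}$ is a nonarchimedean seminorm on it (i.e. it is nonnegative, vanishes at $0$ and satisfies the strong triangle inequality). If $0<b\le 1$, then $|\cdot|_{W,b}$ is a power-multiplicative seminorm on $\overleftarrow{W}^b(R)$. If $b>1$, then $|\cdot|_{W,b}$ is equivalent to a power-multiplicative seminorm on $\overleftarrow{W}^b(R)$. -/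

import Mathlib

namespace OverconvergentWitt

open Filter Topology

noncomputable section

/-! ### Seminorms -/

/-- A nonarchimedean seminorm on an abelian group. -/
structure IsNonarchSeminorm {G : Type*} [AddCommGroup G] (f : G → ℝ) : Prop where
  nonneg : ∀ x, 0 ≤ f x
  map_zero : f 0 = 0
  add_le_max : ∀ x y, f (x + y) ≤ max (f x) (f y)

/-- A power-multiplicative nonarchimedean seminorm on a commutative ring: submultiplicative,
and `|x ^ 2| ≥ |x| ^ 2` for all `x`. -/
structure IsPowerMultiplicativeSeminorm {T : Type*} [CommRing T] (f : T → ℝ) : Prop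
    extends IsNonarchSeminorm f where
  mul_le : ∀ x y, f (x * y) ≤ f x * f y
  sq_le : ∀ x, f x ^ 2 ≤ f (x ^ 2)

/-- Metric equivalence of two seminorms. -/
def MetricallyEquivalent {G : Type*} (f g : G → ℝ) : Prop :=
  ∃ c₁ c₂ : ℝ, 0 < c₁ ∧ 0 < c₂ ∧ ∀ x, f x ≤ c₁ * g x ∧ g x ≤ c₂ * f x

/-! ### `p`-normal rings and the `p`-adic seminorm -/

/-- A ring `A` is `p`-normal if it is `p`-torsion-free and integrally closed in `A[1/p]`. -/
structure IsPNormal (p : ℕ) (A : Type*) [CommRing A] : Prop where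
  torsionFree : ∀ a : A, (p : A) * a = 0 → a = 0
  integrallyClosed : IsIntegrallyClosedIn A (Localization.Away (p : A))

/-- The element `p` as a unit of `A[1/p]`. -/
def pUnit (p : ℕ) (A : Type*) [CommRing A] : (Localization.Away (p : A))ˣ :=
  (IsLocalization.Away.algebraMap_isUnit (S := Localization.Away (p : A)) (p : A)).unit

/-- The `p`-adic seminorm on `A[1/p]`: the infimum of `p ^ (-c / d)` over all integers `c`, `d`
with `d > 0` and `p ^ (-c) * x ^ d ∈ A`. -/
def padicSeminorm (p : ℕ) (A : Type*) [CommRing A] (x : Localization.Away (p : A)) : ℝ :=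
  sInf {r : ℝ | ∃ (c : ℤ) (d : ℕ), 0 < d ∧
    ((pUnit p A ^ (-c) : (Localization.Away (p : A))ˣ) : Localization.Away (p : A)) * x ^ d ∈
      (algebraMap A (Localization.Away (p : A))).range ∧
    r = (p : ℝ) ^ (-((c : ℝ) / (d : ℝ)))}

/-! ### Truncated Witt vectors under Frobenius, and their inverse limit -/

section Witt

variable (p : ℕ) [Fact p.Prime] (R : Type*) [CommRing R]

theorem truncate_frobenius_eq_zero (n : ℕ) (x : WittVector p R)
    (hx : WittVector.truncate (n + 1) x = 0) :
    WittVector.truncate n (WittVector.frobenius x) = 0 := by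
  have h0 : ∀ i < n + 1, x.coeff i = 0 :=
    (WittVector.mem_ker_truncate (n + 1) x).1 hx
  obtain ⟨z, hz⟩ : ∃ z : WittVector p R,
      x = (WittVector.verschiebung : WittVector p R →+ WittVector p R)^[n + 1] z := by
    exact ⟨_, WittVector.eq_iterate_verschiebung h0⟩
  have hV : WittVector.truncate n
      ((WittVector.verschiebung : WittVector p R →+ WittVector p R)^[n] z) = 0 :=
    (WittVector.mem_ker_truncate n _).2
      fun i hi => WittVector.iterate_verschiebung_coeff_eq_zero z hi
  rw [hz, Function.iterate_succ_apply', WittVector.frobenius_verschiebung, map_mul, hV, zero_mul]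

/-- The Witt vector Frobenius `W_{p^n}(R) → W_{p^(n-1)}(R)` on finite length Witt vectors, where
`W_{p^m}(R)` is the ring `TruncatedWittVector p (m + 1) R` of vectors of length `m + 1`. It is
induced by the Frobenius on `W(R)`. -/
def truncFrobenius (n : ℕ) : TruncatedWittVector p (n + 1) R →+* TruncatedWittVector p n R :=
  RingHom.liftOfRightInverse (WittVector.truncate (n + 1)) TruncatedWittVector.out
    (fun x => TruncatedWittVector.truncateFun_out x)
    ⟨(WittVector.truncate n).comp WittVector.frobenius,
      fun x hx => truncate_frobenius_eq_zero p R n x hx⟩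

theorem truncFrobenius_truncate (n : ℕ) (x : WittVector p R) :
    truncFrobenius p R n (WittVector.truncate (n + 1) x) =
      WittVector.truncate n (WittVector.frobenius x) :=
  RingHom.liftOfRightInverse_comp_apply (WittVector.truncate (n + 1)) TruncatedWittVector.out
    (fun x => TruncatedWittVector.truncateFun_out x)
    ⟨(WittVector.truncate n).comp WittVector.frobenius,
      fun x hx => truncate_frobenius_eq_zero p R n x hx⟩ x

/-- The inverse limit of the rings `W_{p^n}(R)`, `n ≥ 0`, under Frobenius. -/
def InverseLimitWitt : Subring (∀ n : ℕ, TruncatedWittVector p (n + 1) R) where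
  carrier := {x | ∀ n, truncFrobenius p R (n + 1) (x (n + 1)) = x n}
  zero_mem' := fun n => by simp
  one_mem' := fun n => by simp
  add_mem' := fun {x y} hx hy n => by
    simp only [Pi.add_apply, map_add]; rw [hx n, hy n]
  mul_mem' := fun {x y} hx hy n => by
    simp only [Pi.mul_apply, map_mul]; rw [hx n, hy n]
  neg_mem' := fun {x} hx n => by
    simp only [Pi.neg_apply, map_neg]; rw [hx n]

variable {R}

/-- `|x|_W = max_i |x_{p^i}| ^ (1 / p^i)` for a Witt vector `x` of finite length, with respect to a
function `ν = |·|` on `R`. -/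
def wittNorm (ν : R → ℝ) {n : ℕ} (x : TruncatedWittVector p n R) : ℝ :=
  ⨆ i : Fin n, ν (x.coeff i) ^ (1 / (p : ℝ) ^ (i : ℕ))

/-- The quantity `p ^ (-b n) * |x_{p^(-n)}|_W ^ (p ^ n)`. -/
def overconvergentTerm (ν : R → ℝ) (b : ℝ) (x : InverseLimitWitt p R) (n : ℕ) : ℝ :=
  (p : ℝ) ^ (-(b * n)) * wittNorm p ν (x.1 n) ^ (p ^ n)

/-- The set `W^b(R)` of overconvergent elements of the inverse limit. -/
def overconvergent (ν : R → ℝ) (b : ℝ) : Set (InverseLimitWitt p R) :=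
  {x | Tendsto (overconvergentTerm p ν b x) atTop (𝓝 0)}

/-- `|x|_{W,b}`; the supremum is over a bounded set when `x` lies in `W^b(R)`. -/
def overconvergentNorm (ν : R → ℝ) (b : ℝ) (x : InverseLimitWitt p R) : ℝ :=
  ⨆ n : ℕ, overconvergentTerm p ν b x n

end Witt

end

end OverconvergentWitt

set_option linter.unusedSectionVars false

namespace OverconvergentWitt

/-! Write `Q = p ^ b`. The heart of the matter is the weighted bound `LevelBound`, `|x_i| ^ (p ^ (n
- i)) ≤ α * Q ^ i` for `i ≤ n`. The n-th term of the norm is at most `α` exactly when the cruder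
bound with `α * Q ^ n` in place of `α * Q ^ i` holds. Frobenius satisfies `F(x)_i ≡ x_i ^ p` modulo
`p`, with an explicitly small error, so crude bounds at all levels from `i` to `n` improve to the
weighted one up to a constant `C` (`coeff_out_le`); for `b ≤ 1` one may take `C = 1`. Hence for `b ≤
1` the norm is at most `α` if and only if the weighted bound with constant `α` holds at every level.

Weighted bounds are stable under addition for `Q ≥ 1`, because Witt vector arithmetic can be carried
out over a suitable subring of `R[T]` after multiplication by `[T]`. For `1 ≤ Q ≤ p` they are also
stable under Frobenius and multiplicative (`WittBound.frobenius`, `WittBound.mul`). This gives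
submultiplicativity when `b ≤ 1`. For squares, overconvergence forces the norm to be attained, at a
high level `N`, at an index `i` with `2 * i ≤ N`. A perturbation of `Q` makes this component
strictly dominant, and the square of `V^i [a]` has component `2 * i` equal to `a ^ (2 * p ^ i)`
times some `1 + p * m`, so no cancellation is possible (`WittBound.not_sq`).

For `b > 1`, dropping the last component at each level gives a ring homomorphism `shift`. The
dropped component is recovered from the ghost component `w`, which is the same at all levels. Since
`p ≤ Q`, the division by a power of `p` is harmless: the norm for `b` is equivalent to `max |w|
(|shift x|_{b/p} ^ p)`, and this construction preserves power-multiplicativity. Iterating reaches `b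
/ p ^ k ≤ 1`. -/

/-- A power-multiplicative nonarchimedean seminorm on a ring, normalized by `|p| = 1 / p` in the
strong sense that multiplication by `p` scales the seminorm. -/
structure IsSpectral (p : ℕ) {R : Type*} [CommRing R] (ν : R → ℝ) : Prop where
  nonneg : ∀ x, 0 ≤ ν x
  map_zero : ν 0 = 0
  map_one_le : ν 1 ≤ 1
  add_le_max : ∀ x y, ν (x + y) ≤ max (ν x) (ν y)
  map_neg : ∀ x, ν (-x) = ν x
  mul_le : ∀ x y, ν (x * y) ≤ ν x * ν y
  map_pow : ∀ x n, 0 < n → ν (x ^ n) = ν x ^ n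
  map_p_mul : ∀ x, ν (p * x) = (p : ℝ)⁻¹ * ν x

/-! ### The p-adic seminorm on `A[1/p]` is spectral. -/

section Padic

variable (p : ℕ) (A : Type*) [CommRing A]

local notation "R" => Localization.Away (p : A)

/-- The condition `p ^ (-c) * x ^ d ∈ A`. -/
def DivPow (c : ℤ) (d : ℕ) (x : R) : Prop :=
  ((pUnit p A ^ (-c) : Rˣ) : R) * x ^ d ∈ (algebraMap A R).range

variable {p A}

theorem coe_pUnit : (pUnit p A : R) = (p : R) := by
  simp [pUnit]

theorem pUnit_zpow_mem {c : ℤ} (hc : 0 ≤ c) :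
    ((pUnit p A ^ c : Rˣ) : R) ∈ (algebraMap A R).range := by
  lift c to ℕ using hc
  rw [zpow_natCast, Units.val_pow_eq_pow_val, coe_pUnit]
  exact pow_mem (natCast_mem _ _) _

theorem DivPow.mono {c c' : ℤ} {d : ℕ} {x : R} (h : DivPow p A c d x) (hc : c' ≤ c) :
    DivPow p A c' d x := by
  have := mul_mem (pUnit_zpow_mem (p := p) (A := A) (sub_nonneg.2 hc)) h
  rwa [← mul_assoc, ← Units.val_mul, ← zpow_add, show c - c' + -c = -c' by ring] at this

theorem DivPow.pow {c : ℤ} {d : ℕ} {x : R} (h : DivPow p A c d x) (m : ℕ) :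
    DivPow p A (c * m) (d * m) x := by
  have := pow_mem h m
  rwa [mul_pow, ← Units.val_pow_eq_pow_val, ← zpow_natCast, ← zpow_mul, ← pow_mul,
    neg_mul] at this

theorem DivPow.mul {c c' : ℤ} {d : ℕ} {x y : R} (h : DivPow p A c d x) (h' : DivPow p A c' d y) :
    DivPow p A (c + c') d (x * y) := by
  have := mul_mem h h'
  unfold DivPow
  rw [neg_add, zpow_add, Units.val_mul, mul_pow]
  convert! this using 1
  ring

theorem DivPow.neg {c : ℤ} {d : ℕ} {x : R} (h : DivPow p A c d x) : DivPow p A c d (-x) := by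
  unfold DivPow
  rw [neg_pow, mul_left_comm]
  exact mul_mem (pow_mem (neg_mem (one_mem _)) _) h

theorem exists_divPow_one (x : R) : ∃ c : ℤ, DivPow p A c 1 x := by
  obtain ⟨n, a, h⟩ := IsLocalization.Away.surj (p : A) x
  refine ⟨-n, a, ?_⟩
  rw [neg_neg, zpow_natCast, Units.val_pow_eq_pow_val, coe_pUnit, ← h, pow_one, mul_comm]
  simp

/-- Put `u = p ^ (-c)`. Each monomial `u * x ^ i * y ^ (d - i)` has d-th power `(u * x ^ d) ^ i * (u
* y ^ d) ^ (d - i)`, which lies in `A`; integral closedness puts the monomial itself in `A`. This is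
where `p`-normality enters, and it yields the strong triangle inequality. -/
theorem DivPow.add (hA : IsPNormal p A) {c : ℤ} {d : ℕ} (hd : 0 < d) {x y : R}
    (hx : DivPow p A c d x) (hy : DivPow p A c d y) : DivPow p A c d (x + y) := by
  have := hA.integrallyClosed
  unfold DivPow
  rw [add_pow, Finset.mul_sum]
  refine sum_mem fun i hi => ?_
  rw [← mul_assoc]
  refine mul_mem ?_ (natCast_mem _ _)
  have hi' : i ≤ d := Finset.mem_range_succ_iff.1 hi
  obtain ⟨a, ha⟩ := mul_mem (pow_mem hx i) (pow_mem hy (d - i))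
  refine IsIntegrallyClosedIn.isIntegral_iff.1 (IsIntegral.of_pow hd ?_)
  rw [show (((pUnit p A ^ (-c) : Rˣ) : R) * (x ^ i * y ^ (d - i))) ^ d = algebraMap A R a by
    rw [ha]
    generalize ((pUnit p A ^ (-c) : Rˣ) : R) = u
    have : u ^ d = u ^ i * u ^ (d - i) := by rw [← pow_add, Nat.add_sub_cancel' hi']
    simp only [mul_pow, this]
    ring]
  exact isIntegral_algebraMap

theorem padicSeminorm_le {c : ℤ} {d : ℕ} {x : R} (hd : 0 < d) (h : DivPow p A c d x) :
    padicSeminorm p A x ≤ (p : ℝ) ^ (-((c : ℝ) / (d : ℝ))) := by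
  refine csInf_le ⟨0, ?_⟩ ⟨c, d, hd, h, rfl⟩
  rintro _ ⟨c, d, -, -, rfl⟩
  positivity

theorem exists_of_padicSeminorm_lt {x : R} {r : ℝ} (h : padicSeminorm p A x < r) :
    ∃ (c : ℤ) (d : ℕ), 0 < d ∧ DivPow p A c d x ∧ (p : ℝ) ^ (-((c : ℝ) / (d : ℝ))) < r := by
  obtain ⟨c, hc⟩ := exists_divPow_one x
  obtain ⟨_, ⟨c, d, hd, h', rfl⟩, h⟩ := exists_lt_of_csInf_lt (by exact ⟨_, c, 1, one_pos, hc, rfl⟩) h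
  exact ⟨c, d, hd, h', h⟩

theorem padicSeminorm_nonneg (x : R) : 0 ≤ padicSeminorm p A x := by
  refine Real.sInf_nonneg ?_
  rintro _ ⟨c, d, -, -, rfl⟩
  positivity

theorem exists_common_of_padicSeminorm_lt {x y : R} {r s : ℝ} (hx : padicSeminorm p A x < r)
    (hy : padicSeminorm p A y < s) :
    ∃ (c c' : ℤ) (d : ℕ), 0 < d ∧ DivPow p A c d x ∧ DivPow p A c' d y ∧
      (p : ℝ) ^ (-((c : ℝ) / (d : ℝ))) < r ∧ (p : ℝ) ^ (-((c' : ℝ) / (d : ℝ))) < s := by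
  obtain ⟨c, d, hd, h, hr⟩ := exists_of_padicSeminorm_lt hx
  obtain ⟨c', d', hd', h', hs⟩ := exists_of_padicSeminorm_lt hy
  have h1 : (d : ℝ) ≠ 0 := by positivity
  have h2 : (d' : ℝ) ≠ 0 := by positivity
  refine ⟨c * d', c' * d, d * d', by positivity, h.pow d', ?_, ?_, ?_⟩
  · rw [mul_comm d]; exact h'.pow d
  · convert! hr using 3; push_cast; field_simp
  · convert! hs using 3; push_cast; field_simp

theorem le_padicSeminorm {x : R} {r : ℝ} (h : ∀ (c : ℤ) (d : ℕ), 0 < d → DivPow p A c d x →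
    r ≤ (p : ℝ) ^ (-((c : ℝ) / (d : ℝ)))) : r ≤ padicSeminorm p A x := by
  refine le_of_forall_gt_imp_ge_of_dense fun t ht => ?_
  obtain ⟨c, d, hd, h', ht⟩ := exists_of_padicSeminorm_lt ht
  exact (h c d hd h').trans ht.le

theorem padicSeminorm_one_le : padicSeminorm p A 1 ≤ 1 := by
  have : DivPow p A 0 1 1 := by simp [DivPow]
  simpa using padicSeminorm_le one_pos this

theorem divPow_p_mul {c : ℤ} {d : ℕ} {x : R} :
    DivPow p A (c + d) d (p * x) ↔ DivPow p A c d x := by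
  unfold DivPow
  rw [mul_pow, ← coe_pUnit, ← Units.val_pow_eq_pow_val, ← mul_assoc, ← Units.val_mul,
    ← zpow_natCast, ← zpow_add, neg_add, neg_add_cancel_right]

variable [hp : Fact p.Prime]

theorem padicSeminorm_mul_le (x y : R) :
    padicSeminorm p A (x * y) ≤ padicSeminorm p A x * padicSeminorm p A y := by
  have hp0 : (0 : ℝ) < p := by exact_mod_cast hp.out.pos
  refine le_of_forall_gt_imp_ge_of_dense fun t ht => ?_
  obtain ⟨r, hr, s, hs, h⟩ : ∃ r, padicSeminorm p A x < r ∧ ∃ s, padicSeminorm p A y < s ∧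
      r * s < t := by
    have hc : Filter.Tendsto (fun e : ℝ => (padicSeminorm p A x + e) * (padicSeminorm p A y + e))
        (nhdsWithin 0 (Set.Ioi 0)) (nhds (padicSeminorm p A x * padicSeminorm p A y)) := by
      refine Filter.Tendsto.mono_left ?_ nhdsWithin_le_nhds
      exact Continuous.tendsto' (by fun_prop) _ _ (by simp)
    obtain ⟨e, he, he'⟩ := ((hc.eventually_lt_const ht).and self_mem_nhdsWithin).exists
    have : 0 < e := he'
    exact ⟨_, by linarith, _, by linarith, he⟩
  obtain ⟨c, c', d, hd, h1, h2, h3, h4⟩ := exists_common_of_padicSeminorm_lt hr hs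
  refine ((padicSeminorm_le hd (h1.mul h2)).trans ?_).trans h.le
  rw [Int.cast_add, add_div, neg_add, Real.rpow_add hp0]
  exact mul_le_mul h3.le h4.le (by positivity) ((Real.rpow_nonneg hp0.le _).trans h3.le)

theorem padicSeminorm_add_le (hA : IsPNormal p A) (x y : R) :
    padicSeminorm p A (x + y) ≤ max (padicSeminorm p A x) (padicSeminorm p A y) := by
  have hp0 : (0 : ℝ) < p := by exact_mod_cast hp.out.pos
  have hp1 : (1 : ℝ) ≤ p := by exact_mod_cast hp.out.one_lt.le
  refine le_of_forall_gt_imp_ge_of_dense fun t ht => ?_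
  obtain ⟨c, c', d, hd, h1, h2, h3, h4⟩ := exists_common_of_padicSeminorm_lt
    ((le_max_left _ _).trans_lt ht) ((le_max_right _ _).trans_lt ht)
  rcases le_total c c' with h | h
  · exact (padicSeminorm_le hd (h1.add hA hd (h2.mono h))).trans h3.le
  · exact (padicSeminorm_le hd ((h1.mono h).add hA hd h2)).trans h4.le

theorem padicSeminorm_zero : padicSeminorm p A 0 = 0 := by
  have hp1 : (1 : ℝ) < p := by exact_mod_cast hp.out.one_lt
  refine le_antisymm ?_ (padicSeminorm_nonneg _)
  have h : ∀ n : ℕ, padicSeminorm p A 0 ≤ ((p : ℝ)⁻¹) ^ n := fun n => by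
    have : DivPow p A n 1 0 := by simp [DivPow]
    simpa [Real.rpow_neg] using padicSeminorm_le one_pos this
  exact ge_of_tendsto' (tendsto_pow_atTop_nhds_zero_of_lt_one (by positivity)
    (inv_lt_one_of_one_lt₀ hp1)) h

theorem padicSeminorm_neg_le (x : R) : padicSeminorm p A (-x) ≤ padicSeminorm p A x :=
  le_padicSeminorm fun _ _ hd h => padicSeminorm_le hd h.neg

/-- For the lower bound, an exponent pair `(c, d)` admissible for `x ^ n` is the pair `(c, n * d)`
for `x`. -/
theorem padicSeminorm_pow (x : R) (n : ℕ) (hn : 0 < n) :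
    padicSeminorm p A (x ^ n) = padicSeminorm p A x ^ n := by
  have hp0 : (0 : ℝ) < p := by exact_mod_cast hp.out.pos
  refine le_antisymm ?_ ?_
  · clear hn
    induction n with
    | zero => simpa using padicSeminorm_one_le
    | succ n ih =>
      rw [pow_succ, pow_succ]
      exact (padicSeminorm_mul_le _ _).trans
        (mul_le_mul_of_nonneg_right ih (padicSeminorm_nonneg _))
  · refine le_padicSeminorm fun c d hd h => ?_
    have h' : DivPow p A c (n * d) x := by unfold DivPow; rw [pow_mul]; exact h
    refine (pow_le_pow_left₀ (padicSeminorm_nonneg _) (padicSeminorm_le (by positivity) h') n).trans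
      (le_of_eq ?_)
    rw [← Real.rpow_natCast, ← Real.rpow_mul hp0.le]
    congr 1
    push_cast
    have : (d : ℝ) ≠ 0 := by positivity
    have : (n : ℝ) ≠ 0 := by positivity
    field_simp

theorem padicSeminorm_p_mul (x : R) :
    padicSeminorm p A (p * x) = (p : ℝ)⁻¹ * padicSeminorm p A x := by
  have hp0 : (0 : ℝ) < p := by exact_mod_cast hp.out.pos
  have key : ∀ (c : ℤ) (d : ℕ), 0 < d →
      (p : ℝ) ^ (-(((c + d : ℤ) : ℝ) / (d : ℝ))) = (p : ℝ)⁻¹ * (p : ℝ) ^ (-((c : ℝ) / (d : ℝ))) := by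
    intro c d hd
    have : (d : ℝ) ≠ 0 := by positivity
    rw [← Real.rpow_neg_one, ← Real.rpow_add hp0]
    congr 1
    push_cast
    field_simp
    ring
  refine le_antisymm ?_ ?_
  · rw [← div_le_iff₀' (by positivity)]
    refine le_padicSeminorm fun c d hd h => ?_
    rw [div_le_iff₀' (by positivity), ← key c d hd]
    exact padicSeminorm_le hd (divPow_p_mul.2 h)
  · refine le_padicSeminorm fun c d hd h => ?_
    obtain ⟨c, rfl⟩ : ∃ c', c = c' + d := ⟨c - d, by ring⟩
    rw [key c d hd]
    gcongr
    exact padicSeminorm_le hd (divPow_p_mul.1 h)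

theorem isSpectral_padicSeminorm (hA : IsPNormal p A) : IsSpectral p (padicSeminorm p A) where
  nonneg := padicSeminorm_nonneg
  map_zero := padicSeminorm_zero
  map_one_le := padicSeminorm_one_le
  add_le_max := padicSeminorm_add_le hA
  map_neg x := le_antisymm (padicSeminorm_neg_le x) (by simpa using padicSeminorm_neg_le (-x))
  mul_le := padicSeminorm_mul_le
  map_pow := padicSeminorm_pow
  map_p_mul := padicSeminorm_p_mul

end Padic

end OverconvergentWitt

/-! ### Witt vector components and homogenization by a Teichmüller variable. -/

namespace OverconvergentWitt

universe u

variable {p : ℕ} [hp : Fact p.Prime] {R : Type u} [CommRing R]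

/-- With `p` invertible the ghost map is injective, so Witt vector identities may be checked on
ghost components. -/
theorem ghostComponent_ext (hpR : IsUnit (p : R)) {x y : WittVector p R}
    (h : ∀ n, WittVector.ghostComponent n x = WittVector.ghostComponent n y) : x = y := by
  obtain ⟨_⟩ := hpR.nonempty_invertible
  exact (WittVector.ghostMap.bijective_of_invertible p R).1 (funext h)

theorem frobenius_teichmuller (hpR : IsUnit (p : R)) (a : R) :
    WittVector.frobenius (WittVector.teichmuller p a) = WittVector.teichmuller p (a ^ p) :=
  ghostComponent_ext hpR fun n => by
    rw [WittVector.ghostComponent_frobenius, WittVector.ghostComponent_teichmuller,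
      WittVector.ghostComponent_teichmuller, ← pow_mul, pow_succ']

theorem map_frobenius {S : Type u} [CommRing S] (f : R →+* S) (x : WittVector p R) :
    WittVector.map f (WittVector.frobenius x) = WittVector.frobenius (WittVector.map f x) :=
  WittVector.IsPoly.map (WittVector.frobenius_isPoly p) f x

theorem coeff_select_eq_ite (P : ℕ → Prop) (x : WittVector p R) (i : ℕ) [Decidable (P i)] :
    (WittVector.select P x).coeff i = if P i then x.coeff i else 0 := by
  rw [WittVector.select, WittVector.coeff_mk]
  congr

theorem coeff_teichmuller_mul (hpR : IsUnit (p : R)) (a : R) (x : WittVector p R) (i : ℕ) :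
    (WittVector.teichmuller p a * x).coeff i = a ^ p ^ i * x.coeff i := by
  suffices h : WittVector.teichmuller p a * x = WittVector.mk p fun i => a ^ p ^ i * x.coeff i by
    rw [h, WittVector.coeff_mk]
  refine ghostComponent_ext hpR fun n => ?_
  simp only [map_mul, WittVector.ghostComponent_teichmuller]
  simp only [WittVector.ghostComponent_apply, wittPolynomial_eq_sum_C_mul_X_pow, map_sum,
    Finset.mul_sum, WittVector.coeff_mk]
  refine Finset.sum_congr rfl fun i hi => ?_
  have hi : i ≤ n := Finset.mem_range_succ_iff.1 hi
  have : a ^ p ^ n = (a ^ p ^ i) ^ p ^ (n - i) := by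
    rw [← pow_mul, ← pow_add, Nat.add_sub_cancel' hi]
  simp [this, mul_pow]
  ring

namespace IsSpectral

variable {ν : R → ℝ} (hν : IsSpectral p ν)
include hν

theorem sub_le_max (x y : R) : ν (x - y) ≤ max (ν x) (ν y) := by
  rw [sub_eq_add_neg, ← hν.map_neg y]; exact hν.add_le_max _ _

theorem sum_le {ι : Type*} (s : Finset ι) (f : ι → R) {r : ℝ} (hr : 0 ≤ r)
    (h : ∀ i ∈ s, ν (f i) ≤ r) : ν (∑ i ∈ s, f i) ≤ r := by
  classical
  induction s using Finset.induction_on with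
  | empty => simpa [hν.map_zero] using hr
  | insert a s ha ih =>
    rw [Finset.sum_insert ha]
    exact (hν.add_le_max _ _).trans (max_le (h a (by simp))
      (ih fun i hi => h i (Finset.mem_insert_of_mem hi)))

theorem pow_le (x : R) (n : ℕ) : ν (x ^ n) ≤ ν x ^ n := by
  rcases n.eq_zero_or_pos with rfl | hn
  · simpa using hν.map_one_le
  · exact (hν.map_pow x n hn).le

theorem natCast_le (n : ℕ) : ν n ≤ 1 := by
  induction n with
  | zero => simp [hν.map_zero]
  | succ n ih => push_cast; exact (hν.add_le_max _ _).trans (max_le ih hν.map_one_le)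

theorem intCast_le (n : ℤ) : ν n ≤ 1 := by
  obtain ⟨n, rfl | rfl⟩ := n.eq_nat_or_neg
  · simpa using hν.natCast_le n
  · simpa [hν.map_neg] using hν.natCast_le n

/-- Polynomials whose coefficient in degree `d` is bounded by `r ^ d * q ^ (d * log_p d)`. -/
def boundedSubring (r q : ℝ) (hr : 0 ≤ r) (hq : 1 ≤ q) : Subring (Polynomial R) where
  carrier := {f | ∀ d, ν (f.coeff d) ≤ r ^ d * q ^ (d * Nat.log p d)}
  zero_mem' d := by simp only [Polynomial.coeff_zero, hν.map_zero]; positivity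
  one_mem' d := by
    rw [Polynomial.coeff_one]
    split_ifs with h
    · subst h; simpa using hν.map_one_le
    · rw [hν.map_zero]; positivity
  add_mem' {f g} hf hg d := by
    rw [Polynomial.coeff_add]; exact (hν.add_le_max _ _).trans (max_le (hf d) (hg d))
  neg_mem' {f} hf d := by rw [Polynomial.coeff_neg, hν.map_neg]; exact hf d
  mul_mem' {f g} hf hg d := by
    rw [Polynomial.coeff_mul]
    refine hν.sum_le _ _ (by positivity) fun ⟨i, j⟩ hij => (hν.mul_le _ _).trans ?_
    rw [Finset.HasAntidiagonal.mem_antidiagonal] at hij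
    subst hij
    refine (mul_le_mul (hf i) (hg j) (hν.nonneg _) (by positivity)).trans ?_
    rw [mul_mul_mul_comm, ← pow_add, ← pow_add]
    -- The exponent `d * log_p d` is superadditive, since both logarithms are at most that of the
    -- sum.
    refine mul_le_mul_of_nonneg_left (pow_le_pow_right₀ hq ?_) (by positivity)
    rw [add_mul]
    exact Nat.add_le_add (Nat.mul_le_mul_left _ (Nat.log_mono_right (by simp)))
      (Nat.mul_le_mul_left _ (Nat.log_mono_right (by simp)))

theorem coeff_le_of_mem_boundedSubring {r q : ℝ} {hr : 0 ≤ r} {hq : 1 ≤ q} {f : Polynomial R}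
    (hf : f ∈ hν.boundedSubring r q hr hq) (i : ℕ) :
    ν (f.coeff (p ^ i)) ≤ (r * q ^ i) ^ p ^ i := by
  refine (hf (p ^ i)).trans_eq ?_
  rw [Nat.log_pow hp.out.one_lt, mul_pow, ← pow_mul, mul_comm i]

end IsSpectral

/-- The bound `|x_i| ≤ (r * q ^ i) ^ (p ^ i)` on the first `N` components of a Witt vector. -/
def WittBound (ν : R → ℝ) (N : ℕ) (r q : ℝ) (x : WittVector p R) : Prop :=
  ∀ i < N, ν (x.coeff i) ≤ (r * q ^ i) ^ p ^ i

/-- The Witt vector `[T] * x` over `R[T]`. -/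
noncomputable def homogenize (x : WittVector p R) : WittVector p (Polynomial R) :=
  WittVector.teichmuller p Polynomial.X * WittVector.map Polynomial.C x

theorem homogenize_add (x y : WittVector p R) :
    homogenize (x + y) = homogenize x + homogenize y := by
  simp [homogenize, mul_add]

theorem homogenize_neg (x : WittVector p R) : homogenize (-x) = - homogenize x := by
  simp [homogenize]

theorem isUnit_polynomial (hpR : IsUnit (p : R)) : IsUnit (p : Polynomial R) := by
  simpa using hpR.map (Polynomial.C : R →+* Polynomial R)

theorem coeff_homogenize (hpR : IsUnit (p : R)) (x : WittVector p R) (i : ℕ) :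
    (homogenize x).coeff i = Polynomial.C (x.coeff i) * Polynomial.X ^ p ^ i := by
  rw [homogenize, coeff_teichmuller_mul (isUnit_polynomial hpR), WittVector.map_coeff, mul_comm]

theorem exists_map_subtype {T : Type*} [CommRing T] (S : Subring T) (x : WittVector p T)
    (h : ∀ i, x.coeff i ∈ S) : ∃ y : WittVector p S, WittVector.map S.subtype y = x :=
  ⟨WittVector.mk p fun i => ⟨x.coeff i, h i⟩, by ext i; simp⟩

theorem wittBound_init {ν : R → ℝ} {N : ℕ} {r q : ℝ} {x : WittVector p R} :
    WittBound ν N r q (WittVector.init N x) ↔ WittBound ν N r q x := by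
  refine forall₂_congr fun i hi => ?_
  rw [WittVector.init, coeff_select_eq_ite, if_pos hi]

/-- Only the first `N + 1` components enter, because Frobenius descends to truncated vectors. -/
theorem coeff_frobenius_init (N : ℕ) (x : WittVector p R) {i : ℕ} (hi : i < N) :
    (WittVector.frobenius (WittVector.init (N + 1) x)).coeff i =
      (WittVector.frobenius x).coeff i := by
  have h : WittVector.truncate (N + 1) (WittVector.init (N + 1) x) =
      WittVector.truncate (N + 1) x := by
    ext j
    rw [WittVector.coeff_truncate, WittVector.coeff_truncate, WittVector.init, coeff_select_eq_ite,
      if_pos j.2]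
  have h' := congrArg (truncFrobenius p R N) h
  rw [truncFrobenius_truncate, truncFrobenius_truncate] at h'
  simpa using congrArg (fun y => TruncatedWittVector.coeff ⟨i, hi⟩ y) h'

theorem exists_coeff_frobenius_eq {T : Type*} [CommRing T] (x : WittVector p T) (i : ℕ) :
    ∃ a, (WittVector.frobenius x).coeff i = x.coeff i ^ p + p * a := by
  rw [WittVector.coeff_frobenius, WittVector.frobeniusPoly]
  exact ⟨MvPolynomial.aeval x.coeff (WittVector.frobeniusPolyAux p i), by simp⟩

namespace WittBound

variable {ν : R → ℝ} {N : ℕ} {r q : ℝ} {x y : WittVector p R}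

/-- The i-th component is a monomial of degree `p ^ i`, where the floor logarithm is exactly `i`, so
the two bounds coincide. `init` removes the components about which nothing is assumed. -/
theorem coeff_homogenize_mem (hν : IsSpectral p ν) (hpR : IsUnit (p : R)) (hr : 0 ≤ r)
    (hq : 1 ≤ q) (hx : WittBound ν N r q x) (i : ℕ) :
    (homogenize (WittVector.init N x)).coeff i ∈ hν.boundedSubring r q hr hq := by
  intro d
  rw [coeff_homogenize hpR, Polynomial.coeff_C_mul_X_pow]
  split_ifs with h
  · subst h
    rw [WittVector.init, coeff_select_eq_ite]
    split_ifs with h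
    · refine (hx i h).trans_eq ?_
      rw [Nat.log_pow hp.out.one_lt, mul_pow, ← pow_mul, mul_comm i]
    · rw [hν.map_zero]; positivity
  · rw [hν.map_zero]; positivity

/-- The homogenized vectors lift to Witt vectors over the bounded subring, so their sum does too.
Reading off the coefficient of `T ^ (p ^ i)` gives the bound without any knowledge of the Witt
addition polynomials. -/
theorem add (hν : IsSpectral p ν) (hpR : IsUnit (p : R)) (hr : 0 ≤ r) (hq : 1 ≤ q)
    (hx : WittBound ν N r q x) (hy : WittBound ν N r q y) : WittBound ν N r q (x + y) := by
  rw [← wittBound_init, WittVector.init_add, wittBound_init]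
  intro i _
  obtain ⟨x', hx'⟩ := exists_map_subtype _ _ (hx.coeff_homogenize_mem hν hpR hr hq)
  obtain ⟨y', hy'⟩ := exists_map_subtype _ _ (hy.coeff_homogenize_mem hν hpR hr hq)
  have h := coeff_homogenize hpR (WittVector.init N x + WittVector.init N y) i
  rw [homogenize_add, ← hx', ← hy', ← map_add, WittVector.map_coeff] at h
  have := hν.coeff_le_of_mem_boundedSubring ((x' + y').coeff i).2 i
  rw [← Subring.subtype_apply, h] at this
  simpa using this

theorem neg (hν : IsSpectral p ν) (hpR : IsUnit (p : R)) (hr : 0 ≤ r) (hq : 1 ≤ q)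
    (hx : WittBound ν N r q x) : WittBound ν N r q (-x) := by
  rw [← wittBound_init, WittVector.init_neg, wittBound_init]
  intro i _
  obtain ⟨x', hx'⟩ := exists_map_subtype _ _ (hx.coeff_homogenize_mem hν hpR hr hq)
  have h := coeff_homogenize hpR (-WittVector.init N x) i
  rw [homogenize_neg, ← hx', ← map_neg, WittVector.map_coeff] at h
  have := hν.coeff_le_of_mem_boundedSubring ((-x').coeff i).2 i
  rw [← Subring.subtype_apply, h] at this
  simpa using this

theorem sub (hν : IsSpectral p ν) (hpR : IsUnit (p : R)) (hr : 0 ≤ r) (hq : 1 ≤ q)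
    (hx : WittBound ν N r q x) (hy : WittBound ν N r q y) : WittBound ν N r q (x - y) := by
  rw [sub_eq_add_neg]; exact hx.add hν hpR hr hq (hy.neg hν hpR hr hq)

theorem mono_radius {s : ℝ} (hr : 0 ≤ r) (hq : 0 ≤ q) (hx : WittBound ν N r q x) (h : r ≤ s) :
    WittBound ν N s q x := fun i hi => (hx i hi).trans (by gcongr)

/-- Over the bounded subring, `F(x)_i = x_i ^ p + p * a` with `a` again in that subring; the factor
`p` gives the gain `p⁻¹`. -/
theorem coeff_frobenius_sub_le (hν : IsSpectral p ν) (hpR : IsUnit (p : R)) (hr : 0 ≤ r)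
    (hq : 1 ≤ q) (hx : WittBound ν (N + 1) r q x) {i : ℕ} (hi : i < N) :
    ν ((WittVector.frobenius x).coeff i - x.coeff i ^ p) ≤
      (p : ℝ)⁻¹ * (r * q ^ (i + 1)) ^ p ^ (i + 1) := by
  obtain ⟨x', hx'⟩ := exists_map_subtype _ _ (hx.coeff_homogenize_mem hν hpR hr hq)
  obtain ⟨a, ha⟩ := exists_coeff_frobenius_eq x' i
  have hT : WittVector.frobenius (homogenize (WittVector.init (N + 1) x)) =
      WittVector.teichmuller p (Polynomial.X ^ p) *
        WittVector.map Polynomial.C (WittVector.frobenius (WittVector.init (N + 1) x)) := by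
    rw [homogenize, map_mul, frobenius_teichmuller (isUnit_polynomial hpR), map_frobenius]
  -- Since `F [T] = [T ^ p]`, the component of index `i` lives in degree `p ^ (i + 1)`.
  have h1 := congrArg (fun z => (WittVector.coeff z i).coeff (p ^ (i + 1))) hT
  rw [coeff_teichmuller_mul (isUnit_polynomial hpR), WittVector.map_coeff, coeff_frobenius_init N x hi,
    ← pow_mul, ← pow_succ', mul_comm, Polynomial.coeff_C_mul_X_pow, if_pos rfl, ← hx',
    ← map_frobenius, WittVector.map_coeff, ha, map_add, map_pow, ← WittVector.map_coeff,
    hx', coeff_homogenize hpR, mul_pow, ← pow_mul, ← pow_succ, ← map_pow, Polynomial.coeff_add,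
    Polynomial.coeff_C_mul_X_pow, if_pos rfl, WittVector.init, coeff_select_eq_ite,
    if_pos (by omega)] at h1
  rw [← h1, add_sub_cancel_left, map_mul, map_natCast, Polynomial.coeff_natCast_mul, hν.map_p_mul]
  gcongr
  exact hν.coeff_le_of_mem_boundedSubring a.2 (i + 1)

end WittBound

end OverconvergentWitt

/-! ### Frobenius, products and squares under Witt bounds. -/

namespace OverconvergentWitt

universe u

variable {p : ℕ} [hp : Fact p.Prime] {R : Type u} [CommRing R]

theorem eq_teichmuller_add_verschiebung (x : WittVector p R) :
    x = WittVector.teichmuller p (x.coeff 0) +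
      WittVector.verschiebung (WittVector.mk p fun i => x.coeff (i + 1)) := by
  ext i
  rw [WittVector.coeff_add_of_disjoint]
  · cases i with
    | zero => simp
    | succ i => simp [WittVector.teichmuller_coeff_pos, WittVector.verschiebung_coeff_succ]
  · intro n
    cases n with
    | zero => right; simp
    | succ n => left; exact WittVector.teichmuller_coeff_pos p _ _ n.succ_pos

/-- The computation takes place over `ℤ` and reduces to `ZMod p`, where this component is `1`. -/
theorem coeff_natCast_pow_self (i : ℕ) :
    ∃ m : ℤ, ((p : WittVector p R) ^ i).coeff i = 1 + p * (m : R) := by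
  have h : (p : ℤ) ∣ ((p : WittVector p ℤ) ^ i).coeff i - 1 := by
    rw [← CharP.intCast_eq_zero_iff (ZMod p), Int.cast_sub, Int.cast_one, sub_eq_zero,
      ← eq_intCast (Int.castRingHom (ZMod p)), ← WittVector.map_coeff, map_pow, map_natCast]
    exact WittVector.coeff_p_pow p (ZMod p) i
  obtain ⟨m, hm⟩ := h
  refine ⟨m, ?_⟩
  rw [← map_natCast (WittVector.map (Int.castRingHom R)), ← map_pow, WittVector.map_coeff,
    ← sub_add_cancel ((p ^ i : WittVector p ℤ).coeff i) 1, hm]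
  simp [add_comm]

theorem iterate_frobenius_iterate_verschiebung (x : WittVector p R) (i : ℕ) :
    WittVector.frobenius^[i] (WittVector.verschiebung^[i] x) = (p : WittVector p R) ^ i * x := by
  induction i with
  | zero => simp
  | succ i ih =>
    rw [Function.iterate_succ_apply, Function.iterate_succ_apply' WittVector.verschiebung,
      WittVector.frobenius_verschiebung]
    rw [← RingHom.coe_pow, map_mul, map_natCast, RingHom.coe_pow, ih]
    ring

/-- By the projection formula and `F^i V^i = p ^ i`, the square of `V^i [a]` is `V^i (p ^ i * [a ^
2])`. -/
theorem coeff_sq_iterate_verschiebung_teichmuller (hpR : IsUnit (p : R)) (a : R) (i : ℕ) :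
    ∃ m : ℤ, ((WittVector.verschiebung^[i] (WittVector.teichmuller p a)) *
      (WittVector.verschiebung^[i] (WittVector.teichmuller p a))).coeff (i + i) =
        (a ^ 2) ^ p ^ i * (1 + p * m) := by
  obtain ⟨m, hm⟩ := coeff_natCast_pow_self (p := p) (R := R) i
  refine ⟨m, ?_⟩
  rw [WittVector.iterate_verschiebung_mul_left, WittVector.iterate_verschiebung_coeff,
    iterate_frobenius_iterate_verschiebung, mul_left_comm, mul_comm, ← map_mul, ← sq,
    coeff_teichmuller_mul hpR, hm]

/-- Otherwise `|c| ≤ |p * c * m| ≤ |c| / p`, which forces `|c| = 0`. -/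
theorem IsSpectral.le_mul_one_add {ν : R → ℝ} (hν : IsSpectral p ν) (c : R) (m : ℤ) :
    ν c ≤ ν (c * (1 + p * m)) := by
  have hp1 : (1 : ℝ) < p := by exact_mod_cast hp.out.one_lt
  have h1 : ν c ≤ max (ν (c * (1 + p * m))) (ν (p * (c * m))) := by
    convert! hν.sub_le_max (c * (1 + p * m)) (p * (c * m)) using 2
    ring
  rcases le_max_iff.1 h1 with h | h
  · exact h
  · rw [hν.map_p_mul] at h
    have h2 : ν (c * m) ≤ ν c := (hν.mul_le _ _).trans
      (mul_le_of_le_one_right (hν.nonneg _) (hν.intCast_le m))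
    have h3 : (p : ℝ)⁻¹ < 1 := inv_lt_one_of_one_lt₀ hp1
    have h4 : (0 : ℝ) < (p : ℝ)⁻¹ := by positivity
    have : ν c ≤ 0 := by nlinarith [hν.nonneg c]
    exact this.trans (hν.nonneg _)

namespace WittBound

variable {ν : R → ℝ} {N : ℕ} {r s q : ℝ} {x y : WittVector p R}

/-- The error term exceeds the desired bound by the factor `q ^ (p ^ (i + 1)) / p`, which is at most
`1` by `hqN`. -/
theorem frobenius (hν : IsSpectral p ν) (hpR : IsUnit (p : R)) (hr : 0 ≤ r) (hq : 1 ≤ q)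
    (hqN : q ^ p ^ N ≤ p) (hx : WittBound ν (N + 1) r q x) :
    WittBound ν N (r ^ p) (q ^ p) (WittVector.frobenius x) := by
  have hp0 : (0 : ℝ) < p := by exact_mod_cast hp.out.pos
  intro i hi
  rw [← add_sub_cancel (x.coeff i ^ p) ((WittVector.frobenius x).coeff i)]
  have e : (r ^ p * (q ^ p) ^ i) ^ p ^ i = (r * q ^ i) ^ p ^ (i + 1) := by
    rw [← pow_mul, mul_comm p i, pow_mul, ← mul_pow, ← pow_mul, pow_succ']
  refine (hν.add_le_max _ _).trans (max_le ?_ ?_)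
  · refine (hν.pow_le _ _).trans
      ((pow_le_pow_left₀ (hν.nonneg _) (hx i (by omega)) p).trans_eq ?_)
    rw [e, ← pow_mul, ← pow_succ]
  · refine (hx.coeff_frobenius_sub_le hν hpR hr hq hi).trans ?_
    rw [e, pow_succ, ← mul_assoc r, mul_pow _ q, mul_comm _ (q ^ _), ← mul_assoc]
    refine mul_le_of_le_one_left (by positivity) ?_
    rw [inv_mul_le_iff₀ hp0, mul_one]
    exact (pow_le_pow_right₀ hq (Nat.pow_le_pow_right hp.out.pos hi)).trans hqN

theorem teichmuller_mul (hν : IsSpectral p ν) (hpR : IsUnit (p : R)) (hr : 0 ≤ r) {a : R}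
    (ha : ν a ≤ r) (hx : WittBound ν N s q x) :
    WittBound ν N (r * s) q (WittVector.teichmuller p a * x) := by
  intro i hi
  rw [coeff_teichmuller_mul hpR, mul_assoc, mul_pow]
  exact (hν.mul_le _ _).trans (mul_le_mul ((hν.pow_le _ _).trans
    (pow_le_pow_left₀ (hν.nonneg _) ha _)) (hx i hi) (hν.nonneg _) (by positivity))

/-- Write `x = [x_0] + V x'` and use `V x' * y = V (x' * F y)`. The induction passes from `(N, q)`
to `(N - 1, q ^ p)`, which leaves the condition `q ^ (p ^ N) ≤ p` unchanged. -/
theorem mul (hν : IsSpectral p ν) (hpR : IsUnit (p : R)) (hr : 0 ≤ r) (hs : 0 ≤ s) (hq : 1 ≤ q)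
    (hqN : q ^ p ^ N ≤ p) (hx : WittBound ν (N + 1) r q x) (hy : WittBound ν (N + 1) s q y) :
    WittBound ν (N + 1) (r * s) q (x * y) := by
  induction N generalizing r s q x y with
  | zero =>
    intro i hi
    obtain rfl : i = 0 := by omega
    have h1 := hx 0 (by omega)
    have h2 := hy 0 (by omega)
    simp only [pow_zero, mul_one, pow_one] at h1 h2 ⊢
    rw [WittVector.mul_coeff_zero]
    exact (hν.mul_le _ _).trans (mul_le_mul h1 h2 (hν.nonneg _) hr)
  | succ N ih =>
    have hx0 : ν (x.coeff 0) ≤ r := by simpa using hx 0 (by omega)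
    rw [eq_teichmuller_add_verschiebung x, add_mul, ← WittVector.verschiebung_mul_frobenius]
    refine (hy.teichmuller_mul hν hpR hr hx0).add hν hpR (by positivity) hq ?_
    have hx' : WittBound ν (N + 1) ((r * q) ^ p) (q ^ p)
        (WittVector.mk p fun i => x.coeff (i + 1)) := fun i hi => by
      rw [WittVector.coeff_mk]
      refine (hx (i + 1) (by omega)).trans_eq ?_
      rw [← pow_mul, mul_comm p i, pow_mul, ← mul_pow, ← pow_mul, pow_succ' p, mul_assoc r,
        ← pow_succ' q]
    have h := ih (by positivity) (by positivity) (one_le_pow₀ hq)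
      (by rwa [← pow_mul, ← pow_succ']) hx' (hy.frobenius hν hpR hs hq hqN)
    intro i hi
    cases i with
    | zero => rw [WittVector.verschiebung_coeff_zero, hν.map_zero]; positivity
    | succ i =>
      rw [WittVector.verschiebung_coeff_succ]
      refine (h i (by omega)).trans_eq ?_
      rw [← pow_mul, mul_comm p i, pow_mul, ← mul_pow, ← mul_pow, ← pow_mul, pow_succ' p]
      congr 1
      ring

/-- Isolate the dominant part `z = V^i [x_i]` and set `w = x - z`. If `x ^ 2` were too small, then
so would be `z ^ 2 = x ^ 2 - w * (x + z)`, contradicting the exact size of its component `2 * i`. -/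
theorem not_sq_of_strict (hν : IsSpectral p ν) (hpR : IsUnit (p : R)) {t : ℝ} (ht : 0 ≤ t)
    (hs : 0 ≤ s) (hsr : s < r) (hq : 1 ≤ q) (hqN : q ^ p ^ N ≤ p) {i : ℕ} (hi : i + i ≤ N)
    (hxi : ν (x.coeff i) = (r * q ^ i) ^ p ^ i)
    (hxj : ∀ j < N + 1, j ≠ i → ν (x.coeff j) ≤ (s * q ^ j) ^ p ^ j) (htr : t < r ^ 2) :
    ¬ WittBound ν (N + 1) t q (x * x) := by
  classical
  intro hsq
  have hr : 0 ≤ r := hs.trans hsr.le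
  set z := WittVector.select (fun j => j = i) x with hz
  set w := WittVector.select (fun j => ¬ j = i) x with hw
  have hzw : z + w = x := WittVector.select_add_select_not _ _
  have hzV : z = WittVector.verschiebung^[i] (WittVector.teichmuller p (x.coeff i)) := by
    ext j
    rw [hz, coeff_select_eq_ite]
    split_ifs with h
    · subst h
      simpa using (WittVector.iterate_verschiebung_coeff
        (WittVector.teichmuller p (x.coeff j)) j 0).symm
    · rcases lt_or_gt_of_ne h with h | h
      · rw [WittVector.iterate_verschiebung_coeff_eq_zero _ h]
      · obtain ⟨k, rfl⟩ := Nat.exists_eq_add_of_lt h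
        rw [show i + k + 1 = (k + 1) + i by ring, WittVector.iterate_verschiebung_coeff,
          WittVector.teichmuller_coeff_pos _ _ _ k.succ_pos]
  have hbz : WittBound ν (N + 1) r q z := fun j hj => by
    rw [hz, coeff_select_eq_ite]
    split_ifs with h
    · subst h; exact hxi.le
    · rw [hν.map_zero]; positivity
  have hbw : WittBound ν (N + 1) s q w := fun j hj => by
    rw [hw, coeff_select_eq_ite]
    split_ifs with h
    · rw [hν.map_zero]; positivity
    · exact hxj j hj h
  have hbx : WittBound ν (N + 1) r q (x + z) := by
    rw [← hzw]
    have := hbw.mono_radius hs (zero_le_one.trans hq) hsr.le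
    exact (hbz.add hν hpR hr hq this).add hν hpR hr hq hbz
  have hzz : z * z = x * x - w * (x + z) := by rw [← hzw]; ring
  have hm : max t (s * r) < r ^ 2 := max_lt htr (by nlinarith)
  have hbzz : WittBound ν (N + 1) (max t (s * r)) q (z * z) := by
    rw [hzz]
    exact (hsq.mono_radius ht (by positivity) (le_max_left _ _)).sub hν hpR (by positivity) hq
      ((hbw.mul hν hpR hs hr hq hqN hbx).mono_radius (by positivity) (by positivity)
        (le_max_right _ _))
  obtain ⟨m, hm'⟩ := coeff_sq_iterate_verschiebung_teichmuller hpR (x.coeff i) i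
  have h := hbzz (i + i) (by omega)
  rw [hzV, hm'] at h
  have h1 := (hν.le_mul_one_add _ m).trans h
  have hpp : 0 < p := hp.out.pos
  rw [← pow_mul, hν.map_pow _ _ (by positivity), hxi] at h1
  refine absurd h1 (not_le.2 ?_)
  have e : ((r * q ^ i) ^ p ^ i) ^ (2 * p ^ i) = (r ^ 2 * q ^ (i + i)) ^ p ^ (i + i) := by
    rw [← pow_mul, mul_left_comm, pow_mul, ← pow_add, mul_pow, ← pow_mul q, mul_two i]
  rw [e]
  gcongr

/-- If the smallest bound `r` for `x` is attained at a component in the lower half of the range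
and at no later component, then `r ^ 2` is the smallest bound for `x ^ 2`. -/
theorem not_sq (hν : IsSpectral p ν) (hpR : IsUnit (p : R)) {t : ℝ} (ht : 0 ≤ t)
    (hr : 0 < r) (hq : 1 < q) (hqN : q ^ p ^ N ≤ p) {i : ℕ} (hi : i + i ≤ N)
    (hx : WittBound ν (N + 1) r q x) (hxi : ν (x.coeff i) = (r * q ^ i) ^ p ^ i)
    (hxj : ∀ j < N + 1, i < j → ν (x.coeff j) < (r * q ^ j) ^ p ^ j) (htr : t < r ^ 2) :
    ¬ WittBound ν (N + 1) t q (x * x) := by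
  intro hsq
  have hpp : 0 < p := hp.out.pos
  have hq0 : 0 < q := one_pos.trans hq
  -- The finitely many strict inequalities beyond `i` persist for a radius `σ` slightly below `r`.
  obtain ⟨σ, hσ0, hσr, hσ⟩ : ∃ σ, 0 ≤ σ ∧ σ < r ∧
      ∀ j < N + 1, i < j → ν (x.coeff j) ≤ (σ * q ^ j) ^ p ^ j := by
    have h : ∀ᶠ σ in nhdsWithin r (Set.Iio r), ∀ j ∈ Finset.range (N + 1), i < j →
        ν (x.coeff j) ≤ (σ * q ^ j) ^ p ^ j := by
      rw [Filter.eventually_all_finset]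
      intro j hj
      by_cases hij : i < j
      · have hc : Filter.Tendsto (fun σ : ℝ => (σ * q ^ j) ^ p ^ j) (nhdsWithin r (Set.Iio r))
            (nhds ((r * q ^ j) ^ p ^ j)) :=
          (Continuous.tendsto (by fun_prop) r).mono_left nhdsWithin_le_nhds
        filter_upwards [hc.eventually_const_lt (hxj j (Finset.mem_range.1 hj) hij)] with σ h _
          using h.le
      · exact Filter.Eventually.of_forall fun σ h => absurd h hij
    obtain ⟨σ, h1, h2, h3⟩ := (h.and ((Filter.Eventually.and
      (mem_nhdsWithin_of_mem_nhds (lt_mem_nhds hr)) self_mem_nhdsWithin))).exists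
    exact ⟨σ, le_of_lt h2, h3, fun j hj => h1 j (Finset.mem_range.2 hj)⟩
  -- Replacing `q` by `q / l` multiplies the radius at index `j` by `l ^ j`. This separates the
  -- indices below `i` from `i`, and for `l` close to `1` it does not destroy the gap above `i`.
  obtain ⟨l, hl1, hlq, hlσ, hlt⟩ : ∃ l : ℝ, 1 < l ∧ l < q ∧ σ * l ^ N < r ∧
      t * l ^ N < r ^ 2 := by
    have h1 : Filter.Tendsto (fun l : ℝ => σ * l ^ N) (nhdsWithin 1 (Set.Ioi 1)) (nhds σ) :=
      (Continuous.tendsto' (by fun_prop) _ _ (by simp)).mono_left nhdsWithin_le_nhds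
    have h2 : Filter.Tendsto (fun l : ℝ => t * l ^ N) (nhdsWithin 1 (Set.Ioi 1)) (nhds t) :=
      (Continuous.tendsto' (by fun_prop) _ _ (by simp)).mono_left nhdsWithin_le_nhds
    obtain ⟨l, h1, h2, h3, h4⟩ := ((h1.eventually_lt_const hσr).and
      ((h2.eventually_lt_const htr).and (Filter.Eventually.and
      (mem_nhdsWithin_of_mem_nhds (gt_mem_nhds hq)) self_mem_nhdsWithin))).exists
    exact ⟨l, h4, h3, h1, h2⟩
  have hl0 : 0 < l := one_pos.trans hl1
  have e : ∀ (a : ℝ) (j : ℕ), a * q ^ j = (a * l ^ j) * (q / l) ^ j := fun a j => by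
    rw [mul_assoc, ← mul_pow, mul_div_cancel₀ _ hl0.ne']
  have hq' : 1 ≤ q / l := by rw [one_le_div hl0]; exact hlq.le
  have hqN' : (q / l) ^ p ^ N ≤ p :=
    (pow_le_pow_left₀ (by positivity) (div_le_self hq0.le hl1.le) _).trans hqN
  have hli : r ≤ r * l ^ i := le_mul_of_one_le_right hr.le (one_le_pow₀ hl1.le)
  have hrl : r * l ^ i / l < r * l ^ i := div_lt_self (by positivity) hl1
  refine not_sq_of_strict hν hpR (t := t * l ^ N) (s := max (r * l ^ i / l) (σ * l ^ N))
    (r := r * l ^ i) (q := q / l) (x := x) (by positivity) (by positivity)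
    (max_lt hrl (hlσ.trans_le hli)) hq' hqN' hi (by rw [hxi, e]) ?_
    (hlt.trans_le (pow_le_pow_left₀ hr.le hli 2)) ?_
  · intro j hj hji
    rcases lt_or_gt_of_ne hji with h | h
    · refine (hx j hj).trans ?_
      rw [e]
      gcongr
      refine le_trans ?_ (le_max_left _ _)
      rw [mul_div_assoc]
      gcongr
      rw [le_div_iff₀ hl0, ← pow_succ]
      exact pow_le_pow_right₀ hl1.le h
    · refine (hσ j hj h).trans ?_
      rw [e]
      gcongr
      refine le_trans ?_ (le_max_right _ _)
      gcongr
      · exact hl1.le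
      · omega
  · intro j hj
    refine (hsq j hj).trans ?_
    rw [e]
    gcongr
    · exact hl1.le
    · omega

end WittBound

end OverconvergentWitt

/-! ### Level bounds and the terms of the overconvergent norm. -/

namespace OverconvergentWitt

open Filter Topology

universe u

variable {p : ℕ} [hp : Fact p.Prime] {R : Type u} [CommRing R]

/-- The bound `|x_i| ^ (p ^ (n - i)) ≤ α * Q ^ i` on the components of index at most `n` of a
Witt vector. -/
def LevelBound (ν : R → ℝ) (Q : ℝ) (n : ℕ) (α : ℝ) (x : WittVector p R) : Prop :=
  ∀ i ≤ n, ν (x.coeff i) ^ p ^ (n - i) ≤ α * Q ^ i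

theorem exists_pow_eq (n : ℕ) {α : ℝ} (hα : 0 ≤ α) : ∃ r : ℝ, 0 ≤ r ∧ r ^ p ^ n = α :=
  ⟨α ^ ((p ^ n : ℕ) : ℝ)⁻¹, by positivity,
    Real.rpow_inv_natCast_pow hα (pow_ne_zero _ hp.out.ne_zero)⟩

theorem pow_pow_sub {i n : ℕ} (hi : i ≤ n) (a : ℝ) : (a ^ p ^ i) ^ p ^ (n - i) = a ^ p ^ n := by
  rw [← pow_mul, ← pow_add, Nat.add_sub_cancel' hi]

/-- The dictionary is `Q = q ^ (p ^ n)`, `α = r ^ (p ^ n)`; it turns `q ^ (p ^ n) ≤ p` into the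
level-independent condition `Q ≤ p`. -/
theorem levelBound_iff_wittBound {ν : R → ℝ} (hν : IsSpectral p ν) {q r : ℝ} (hr : 0 ≤ r)
    (hq : 0 ≤ q) {n : ℕ} {x : WittVector p R} :
    LevelBound ν (q ^ p ^ n) n (r ^ p ^ n) x ↔ WittBound ν (n + 1) r q x := by
  refine ⟨fun h i hi => ?_, fun h i hi => ?_⟩
  · have := h i (by omega)
    rw [← pow_mul, mul_comm _ i, pow_mul, ← mul_pow, ← pow_pow_sub (by omega : i ≤ n)] at this
    exact (pow_le_pow_iff_left₀ (hν.nonneg _) (by positivity)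
      (pow_ne_zero _ hp.out.ne_zero)).1 this
  · rw [← pow_mul q, mul_comm _ i, pow_mul, ← mul_pow, ← pow_pow_sub hi]
    exact pow_le_pow_left₀ (hν.nonneg _) (h i (by omega)) _

theorem one_le_of_one_le_pow {q : ℝ} (hq : 0 ≤ q) {n : ℕ} (h : 1 ≤ q ^ p ^ n) : 1 ≤ q :=
  (one_le_pow_iff_of_nonneg hq (pow_ne_zero _ hp.out.ne_zero)).1 h

theorem levelBound_congr {ν : R → ℝ} {Q α : ℝ} {n : ℕ} {x y : WittVector p R}
    (h : WittVector.truncate (n + 1) x = WittVector.truncate (n + 1) y) :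
    LevelBound ν Q n α x ↔ LevelBound ν Q n α y := by
  refine forall₂_congr fun i hi => ?_
  have := congrArg (fun z => TruncatedWittVector.coeff ⟨i, by omega⟩ z) h
  simp only [WittVector.coeff_truncate] at this
  rw [this]

namespace LevelBound

variable {ν : R → ℝ} {Q α β : ℝ} {n : ℕ} {x y : WittVector p R}

theorem mono_const (hQ : 0 ≤ Q) (hx : LevelBound ν Q n α x) (h : α ≤ β) :
    LevelBound ν Q n β x := fun i hi => (hx i hi).trans (by gcongr)

theorem add (hν : IsSpectral p ν) (hpR : IsUnit (p : R)) (hα : 0 ≤ α) (hQ : 1 ≤ Q)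
    (hx : LevelBound ν Q n α x) (hy : LevelBound ν Q n α y) : LevelBound ν Q n α (x + y) := by
  obtain ⟨r, hr, rfl⟩ := exists_pow_eq (p := p) n hα
  obtain ⟨q, hq, rfl⟩ := exists_pow_eq (p := p) n (zero_le_one.trans hQ)
  rw [levelBound_iff_wittBound hν hr hq] at *
  exact hx.add hν hpR hr (one_le_of_one_le_pow hq hQ) hy

theorem neg (hν : IsSpectral p ν) (hpR : IsUnit (p : R)) (hα : 0 ≤ α) (hQ : 1 ≤ Q)
    (hx : LevelBound ν Q n α x) : LevelBound ν Q n α (-x) := by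
  obtain ⟨r, hr, rfl⟩ := exists_pow_eq (p := p) n hα
  obtain ⟨q, hq, rfl⟩ := exists_pow_eq (p := p) n (zero_le_one.trans hQ)
  rw [levelBound_iff_wittBound hν hr hq] at *
  exact hx.neg hν hpR hr (one_le_of_one_le_pow hq hQ)

theorem mul (hν : IsSpectral p ν) (hpR : IsUnit (p : R)) (hα : 0 ≤ α) (hβ : 0 ≤ β) (hQ : 1 ≤ Q)
    (hQp : Q ≤ p) (hx : LevelBound ν Q n α x) (hy : LevelBound ν Q n β y) :
    LevelBound ν Q n (α * β) (x * y) := by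
  obtain ⟨r, hr, rfl⟩ := exists_pow_eq (p := p) n hα
  obtain ⟨s, hs, rfl⟩ := exists_pow_eq (p := p) n hβ
  obtain ⟨q, hq, rfl⟩ := exists_pow_eq (p := p) n (zero_le_one.trans hQ)
  rw [← mul_pow]
  rw [levelBound_iff_wittBound hν (by positivity) hq] at *
  exact hx.mul hν hpR hr hs (one_le_of_one_le_pow hq hQ) hQp hy

theorem frobenius (hν : IsSpectral p ν) (hpR : IsUnit (p : R)) (hα : 0 ≤ α) (hQ : 1 ≤ Q)
    (hQp : Q ≤ p) (hx : LevelBound ν Q (n + 1) α x) :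
    LevelBound ν Q n α (WittVector.frobenius x) := by
  obtain ⟨r, hr, rfl⟩ := exists_pow_eq (p := p) (n + 1) hα
  obtain ⟨q, hq, rfl⟩ := exists_pow_eq (p := p) (n + 1) (zero_le_one.trans hQ)
  rw [levelBound_iff_wittBound hν hr hq] at hx
  rw [pow_succ', pow_mul, pow_mul, levelBound_iff_wittBound hν (by positivity) (by positivity)]
  exact hx.frobenius hν hpR hr (one_le_of_one_le_pow hq hQ) hQp

/-- Normalizing to level `n` raises the gain `p⁻¹` to the power `p ^ (n - i)`, which beats any
exponential in `n - i`. -/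
theorem coeff_frobenius_sub_le (hν : IsSpectral p ν) (hpR : IsUnit (p : R)) (hα : 0 ≤ α)
    (hx : LevelBound ν 1 (n + 1) α x) {i : ℕ} (hi : i ≤ n) :
    ν ((WittVector.frobenius x).coeff i - x.coeff i ^ p) ^ p ^ (n - i) ≤
      ((p : ℝ) ^ p ^ (n - i))⁻¹ * α := by
  obtain ⟨r, hr, rfl⟩ := exists_pow_eq (p := p) (n + 1) hα
  rw [← one_pow (p ^ (n + 1)), levelBound_iff_wittBound hν hr zero_le_one] at hx
  have := pow_le_pow_left₀ (hν.nonneg _)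
    (hx.coeff_frobenius_sub_le hν hpR hr le_rfl (by omega : i < n + 1)) (p ^ (n - i))
  have e : n - i = n + 1 - (i + 1) := by omega
  rwa [one_pow, mul_one, mul_pow, inv_pow, e, pow_pow_sub (by omega : i + 1 ≤ n + 1),
    ← e] at this

theorem to_one (hα : 0 ≤ α) (hQ : 1 ≤ Q) (hx : LevelBound ν Q n α x) :
    LevelBound ν 1 n (α * Q ^ n) x := fun i hi => by
  rw [one_pow, mul_one]
  exact (hx i hi).trans (by gcongr)

theorem not_sq (hν : IsSpectral p ν) (hpR : IsUnit (p : R)) (hβ : 0 ≤ β) (hα : 0 < α)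
    (hQ : 1 < Q) (hQp : Q ≤ p) {i : ℕ} (hi : i + i ≤ n) (hx : LevelBound ν Q n α x)
    (hxi : ν (x.coeff i) ^ p ^ (n - i) = α * Q ^ i)
    (hxj : ∀ j ≤ n, i < j → ν (x.coeff j) ^ p ^ (n - j) < α * Q ^ j) (h : β < α ^ 2) :
    ¬ LevelBound ν Q n β (x * x) := by
  obtain ⟨r, hr, rfl⟩ := exists_pow_eq (p := p) n hα.le
  obtain ⟨t, ht, rfl⟩ := exists_pow_eq (p := p) n hβ
  obtain ⟨q, hq, rfl⟩ := exists_pow_eq (p := p) n (zero_le_one.trans hQ.le)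
  have hp0 := hp.out.ne_zero
  have hpn : p ^ n ≠ 0 := pow_ne_zero _ hp0
  have e : ∀ j ≤ n, r ^ p ^ n * (q ^ p ^ n) ^ j = ((r * q ^ j) ^ p ^ j) ^ p ^ (n - j) := by
    intro j hj
    rw [pow_pow_sub hj, mul_pow, ← pow_mul, ← pow_mul, mul_comm j]
  rw [levelBound_iff_wittBound hν (by assumption) hq] at *
  refine hx.not_sq hν hpR ht ?_ ?_ hQp hi ?_ ?_ ?_
  · refine lt_of_le_of_ne hr fun h0 => ?_
    rw [← h0, zero_pow hpn] at hα
    exact lt_irrefl _ hα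
  · exact (one_lt_pow_iff_of_nonneg hq hpn).1 hQ
  · rw [e i (by omega)] at hxi
    exact (pow_left_inj₀ (hν.nonneg _) (by positivity) (pow_ne_zero _ hp0)).1 hxi
  · intro j hj hij
    have := hxj j (by omega) hij
    rw [e j (by omega)] at this
    exact lt_of_pow_lt_pow_left₀ _ (by positivity) this
  · rw [← pow_mul, mul_comm _ 2, pow_mul] at h
    exact lt_of_pow_lt_pow_left₀ _ (by positivity) h

end LevelBound

section Term

variable {ν : R → ℝ} {b : ℝ}

theorem one_lt_rpow (hb : 0 < b) : 1 < (p : ℝ) ^ b :=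
  Real.one_lt_rpow (by exact_mod_cast hp.out.one_lt) hb

theorem wittNorm_term_le_iff (hν : IsSpectral p ν) {n : ℕ} (x : TruncatedWittVector p (n + 1) R)
    {α : ℝ} (hα : 0 ≤ α) :
    wittNorm p ν x ^ p ^ n ≤ α ↔ LevelBound ν 1 n α x.out := by
  have hpp : 0 < p := hp.out.pos
  obtain ⟨r, hr, rfl⟩ := exists_pow_eq (p := p) n hα
  have h0 : 0 ≤ wittNorm p ν x := Real.iSup_nonneg fun i => Real.rpow_nonneg (hν.nonneg _) _
  have hQ1 := levelBound_iff_wittBound hν hr zero_le_one (n := n) (x := x.out)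
  rw [one_pow] at hQ1
  rw [hQ1, pow_le_pow_iff_left₀ h0 hr (pow_ne_zero _ hpp.ne'), wittNorm, ciSup_le_iff
    (Set.finite_range _).bddAbove]
  have key : ∀ i : Fin (n + 1), ν (x.coeff i) ^ (1 / (p : ℝ) ^ (i : ℕ)) ≤ r ↔
      ν (x.out.coeff i) ≤ (r * 1 ^ (i : ℕ)) ^ p ^ (i : ℕ) := fun i => by
    rw [one_pow, mul_one, TruncatedWittVector.coeff_out, one_div,
      Real.rpow_inv_le_iff_of_pos (hν.nonneg _) hr (by positivity), ← Nat.cast_pow,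
      Real.rpow_natCast]
  exact ⟨fun h i hi => (key ⟨i, hi⟩).1 (h ⟨i, hi⟩), fun h i => (key i).2 (h i i.2)⟩

theorem overconvergentTerm_nonneg (hν : IsSpectral p ν) (x : InverseLimitWitt p R) (n : ℕ) :
    0 ≤ overconvergentTerm p ν b x n := by
  have h0 : 0 ≤ wittNorm p ν (x.1 n) := Real.iSup_nonneg fun i => Real.rpow_nonneg (hν.nonneg _) _
  unfold overconvergentTerm
  positivity

theorem overconvergentTerm_le_iff (hν : IsSpectral p ν) (x : InverseLimitWitt p R) (n : ℕ)
    {α : ℝ} (hα : 0 ≤ α) : overconvergentTerm p ν b x n ≤ α ↔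
      LevelBound ν 1 n (α * ((p : ℝ) ^ b) ^ n) (x.1 n).out := by
  have hp0 : (0 : ℝ) < p := by exact_mod_cast hp.out.pos
  rw [← wittNorm_term_le_iff hν _ (by positivity), overconvergentTerm, Real.rpow_neg hp0.le,
    Real.rpow_mul hp0.le, Real.rpow_natCast, inv_mul_le_iff₀ (by positivity), mul_comm α]

theorem truncate_out {n : ℕ} (x : TruncatedWittVector p n R) :
    WittVector.truncate n x.out = x := TruncatedWittVector.truncateFun_out x

theorem truncate_frobenius_out (x : InverseLimitWitt p R) (n : ℕ) :
    WittVector.truncate (n + 1) (x.1 n).out =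
      WittVector.truncate (n + 1) (WittVector.frobenius (x.1 (n + 1)).out) := by
  rw [← truncFrobenius_truncate, truncate_out, truncate_out, x.2 n]

theorem coeff_frobenius_out (x : InverseLimitWitt p R) {i n : ℕ} (hi : i ≤ n) :
    (WittVector.frobenius (x.1 (n + 1)).out).coeff i = (x.1 n).out.coeff i := by
  have := congrArg (fun z => TruncatedWittVector.coeff ⟨i, by omega⟩ z) (truncate_frobenius_out x n)
  simpa only [WittVector.coeff_truncate] using this.symm

/-- A bound for all terms of index between `i` and `n` controls the component of index `i` at
level `n` better than the term of index `n` alone does. -/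
theorem coeff_out_le (hν : IsSpectral p ν) (hpR : IsUnit (p : R)) {C : ℝ} (hC1 : 1 ≤ C)
    (hC : ∀ k : ℕ, ((p : ℝ) ^ b) ^ (k + 1) ≤ C * p ^ p ^ k) (x : InverseLimitWitt p R) {α : ℝ}
    (hα : 0 ≤ α) {i n : ℕ} (hi : i ≤ n)
    (h : ∀ m, i ≤ m → m ≤ n → overconvergentTerm p ν b x m ≤ α) :
    ν ((x.1 n).out.coeff i) ^ p ^ (n - i) ≤ C * α * ((p : ℝ) ^ b) ^ i := by
  have hp0 : (0 : ℝ) < p := by exact_mod_cast hp.out.pos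
  have hQ0 : 0 < (p : ℝ) ^ b := by positivity
  induction n, hi using Nat.le_induction with
  | base =>
    have := (overconvergentTerm_le_iff hν x i hα).1 (h i le_rfl le_rfl) i le_rfl
    rw [one_pow, mul_one] at this
    refine this.trans ?_
    rw [mul_assoc]
    exact le_mul_of_one_le_left (by positivity) hC1
  | succ n hi ih =>
    have h1 := ih fun m h1 h2 => h m h1 (by omega)
    have h2 := ((overconvergentTerm_le_iff hν x _ hα).1
      (h (n + 1) (by omega) le_rfl)).coeff_frobenius_sub_le hν hpR (by positivity) hi
    rw [coeff_frobenius_out x hi] at h2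
    have h3 : ν ((x.1 (n + 1)).out.coeff i) ^ p ≤ max (ν ((x.1 n).out.coeff i))
        (ν ((x.1 n).out.coeff i - (x.1 (n + 1)).out.coeff i ^ p)) := by
      rw [← hν.map_pow _ _ hp.out.pos]
      convert! hν.sub_le_max ((x.1 n).out.coeff i)
        ((x.1 n).out.coeff i - (x.1 (n + 1)).out.coeff i ^ p) using 2
      ring
    rw [show n + 1 - i = (n - i) + 1 by omega, pow_succ', pow_mul]
    rcases le_max_iff.1 h3 with h | h
    · exact (pow_le_pow_left₀ (pow_nonneg (hν.nonneg _) _) h _).trans h1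
    · refine (pow_le_pow_left₀ (pow_nonneg (hν.nonneg _) _) h _).trans (h2.trans ?_)
      -- The error dominates here; the loss `Q ^ (n - i + 1)` of the crude bound is absorbed by `p ^
      -- (p ^ (n - i))` through `hC`.
      rw [inv_mul_le_iff₀ (by positivity)]
      have := hC (n - i)
      calc α * ((p : ℝ) ^ b) ^ (n + 1) = α * ((p : ℝ) ^ b) ^ i * ((p : ℝ) ^ b) ^ (n - i + 1) := by
            rw [mul_assoc, ← pow_add, show i + (n - i + 1) = n + 1 by omega]
        _ ≤ α * ((p : ℝ) ^ b) ^ i * (C * p ^ p ^ (n - i)) := by gcongr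
        _ = _ := by ring

/-- `b * (k + 1)` is eventually smaller than `p ^ k`. -/
theorem exists_growth_constant (p : ℕ) [hp : Fact p.Prime] (b : ℝ) :
    ∃ C : ℝ, 1 ≤ C ∧ ∀ k : ℕ, ((p : ℝ) ^ b) ^ (k + 1) ≤ C * p ^ p ^ k := by
  have hp1 : (1 : ℝ) < p := by exact_mod_cast hp.out.one_lt
  have hp0 : (0 : ℝ) < p := one_pos.trans hp1
  have hb : BddAbove (Set.range fun k : ℕ => ((p : ℝ) ^ b) ^ (k + 1) / p ^ p ^ k) := by
    refine Filter.IsBoundedUnder.bddAbove_range ⟨1, ?_⟩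
    rw [eventually_map]
    have h1 : Tendsto (fun k : ℕ => b * ((k : ℝ) ^ 1 / (p : ℝ) ^ k + (k : ℝ) ^ 0 / (p : ℝ) ^ k))
        atTop (𝓝 (b * (0 + 0))) :=
      ((tendsto_pow_const_div_const_pow_of_one_lt 1 hp1).add
        (tendsto_pow_const_div_const_pow_of_one_lt 0 hp1)).const_mul b
    rw [add_zero, mul_zero] at h1
    filter_upwards [h1.eventually_lt_const one_pos] with k hk
    rw [div_le_one (by positivity), ← Real.rpow_natCast, ← Real.rpow_mul hp0.le,
      ← Real.rpow_natCast]
    refine Real.rpow_le_rpow_of_exponent_le hp1.le ?_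
    rw [← add_div, mul_div_assoc', div_lt_one (by positivity)] at hk
    push_cast
    simpa using hk.le
  obtain ⟨C, hC⟩ := hb
  refine ⟨max C 1, le_max_right _ _, fun k => ?_⟩
  have := hC ⟨k, rfl⟩
  rw [← div_le_iff₀ (by positivity)]
  exact this.trans (le_max_left _ _)

/-- For `b ≤ 1` the constant is `1`, because `k + 1 ≤ p ^ k`; this is why no equivalent seminorm is
needed in that range. -/
theorem growth_le_of_le_one (hb : b ≤ 1) (k : ℕ) :
    ((p : ℝ) ^ b) ^ (k + 1) ≤ 1 * (p : ℝ) ^ p ^ k := by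
  have hp1 : (1 : ℝ) ≤ p := by exact_mod_cast hp.out.one_lt.le
  rw [one_mul]
  refine (pow_le_pow_left₀ (by positivity) (b := (p : ℝ)) ?_ _).trans
    (pow_le_pow_right₀ hp1 (Nat.lt_pow_self hp.out.one_lt))
  simpa using Real.rpow_le_rpow_of_exponent_le hp1 hb

end Term

end OverconvergentWitt

/-! ### Additive structure of the overconvergent elements. -/

namespace OverconvergentWitt

open Filter Topology

universe u

variable {p : ℕ} [hp : Fact p.Prime] {R : Type u} [CommRing R]

variable {ν : R → ℝ} {b : ℝ}

theorem truncate_out_add (x y : InverseLimitWitt p R) (n : ℕ) :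
    WittVector.truncate (n + 1) ((x + y).1 n).out =
      WittVector.truncate (n + 1) ((x.1 n).out + (y.1 n).out) := by
  rw [map_add, truncate_out, truncate_out, truncate_out]; rfl

theorem truncate_out_neg (x : InverseLimitWitt p R) (n : ℕ) :
    WittVector.truncate (n + 1) ((-x).1 n).out = WittVector.truncate (n + 1) (-(x.1 n).out) := by
  rw [map_neg, truncate_out, truncate_out]; rfl

theorem truncate_out_mul (x y : InverseLimitWitt p R) (n : ℕ) :
    WittVector.truncate (n + 1) ((x * y).1 n).out =
      WittVector.truncate (n + 1) ((x.1 n).out * (y.1 n).out) := by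
  rw [map_mul, truncate_out, truncate_out, truncate_out]; rfl

section Terms

variable (hν : IsSpectral p ν)
include hν

theorem overconvergentTerm_add_le (hpR : IsUnit (p : R)) (x y : InverseLimitWitt p R) (n : ℕ) :
    overconvergentTerm p ν b (x + y) n ≤
      max (overconvergentTerm p ν b x n) (overconvergentTerm p ν b y n) := by
  have hx := overconvergentTerm_nonneg (b := b) hν x n
  have h0 := hx.trans (le_max_left _ (overconvergentTerm p ν b y n))
  rw [overconvergentTerm_le_iff hν _ _ h0, levelBound_congr (truncate_out_add x y n)]
  exact ((overconvergentTerm_le_iff hν x n h0).1 (le_max_left _ _)).add hν hpR (by positivity)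
    le_rfl ((overconvergentTerm_le_iff hν y n h0).1 (le_max_right _ _))

theorem overconvergentTerm_neg_le (hpR : IsUnit (p : R)) (x : InverseLimitWitt p R) (n : ℕ) :
    overconvergentTerm p ν b (-x) n ≤ overconvergentTerm p ν b x n := by
  have hx := overconvergentTerm_nonneg (b := b) hν x n
  rw [overconvergentTerm_le_iff hν _ _ hx, levelBound_congr (truncate_out_neg x n)]
  exact ((overconvergentTerm_le_iff hν x n hx).1 le_rfl).neg hν hpR (by positivity) le_rfl

theorem overconvergentTerm_zero (n : ℕ) :
    overconvergentTerm p ν b (0 : InverseLimitWitt p R) n = 0 := by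
  refine le_antisymm ?_ (overconvergentTerm_nonneg hν _ n)
  rw [overconvergentTerm_le_iff hν _ _ le_rfl, levelBound_congr (y := 0)
    (by rw [truncate_out, map_zero]; rfl)]
  intro i _
  rw [WittVector.zero_coeff, hν.map_zero, zero_pow (pow_ne_zero _ hp.out.ne_zero)]
  simp

theorem overconvergentTerm_one_le (n : ℕ) :
    overconvergentTerm p ν b (1 : InverseLimitWitt p R) n ≤ (((p : ℝ) ^ b)⁻¹) ^ n := by
  have hp0 : (0 : ℝ) < p := by exact_mod_cast hp.out.pos
  rw [overconvergentTerm_le_iff hν _ _ (by positivity), levelBound_congr (y := 1)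
    (by rw [truncate_out, map_one]; rfl), ← mul_pow, inv_mul_cancel₀ (by positivity), one_pow]
  intro i _
  rw [one_pow, mul_one]
  refine pow_le_one₀ (hν.nonneg _) ?_
  rcases i.eq_zero_or_pos with rfl | hi
  · rw [WittVector.one_coeff_zero]; exact hν.map_one_le
  · rw [WittVector.one_coeff_eq_of_pos _ _ _ hi, hν.map_zero]; exact zero_le_one

theorem overconvergentNorm_nonneg (x : InverseLimitWitt p R) : 0 ≤ overconvergentNorm p ν b x :=
  Real.iSup_nonneg (overconvergentTerm_nonneg hν x)

theorem zero_mem_overconvergent : (0 : InverseLimitWitt p R) ∈ overconvergent p ν b := by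
  show Tendsto _ _ _
  simp only [funext (overconvergentTerm_zero hν), tendsto_const_nhds]

theorem one_mem_overconvergent (hb : 0 < b) :
    (1 : InverseLimitWitt p R) ∈ overconvergent p ν b :=
  squeeze_zero (overconvergentTerm_nonneg hν _) (overconvergentTerm_one_le hν)
    (tendsto_pow_atTop_nhds_zero_of_lt_one (by positivity) (inv_lt_one_of_one_lt₀ (one_lt_rpow hb)))

theorem add_mem_overconvergent (hpR : IsUnit (p : R)) {x y : InverseLimitWitt p R}
    (hx : x ∈ overconvergent p ν b) (hy : y ∈ overconvergent p ν b) :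
    x + y ∈ overconvergent p ν b :=
  squeeze_zero (overconvergentTerm_nonneg hν _) (overconvergentTerm_add_le hν hpR x y)
    (by simpa using Tendsto.max hx hy)

theorem neg_mem_overconvergent (hpR : IsUnit (p : R)) {x : InverseLimitWitt p R}
    (hx : x ∈ overconvergent p ν b) : -x ∈ overconvergent p ν b :=
  squeeze_zero (overconvergentTerm_nonneg hν _) (overconvergentTerm_neg_le hν hpR x) hx

theorem mem_overconvergent_of_eventually {x : InverseLimitWitt p R}
    (h : ∀ η : ℝ, 0 < η → ∀ᶠ n in atTop, overconvergentTerm p ν b x n ≤ η) :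
    x ∈ overconvergent p ν b := by
  refine tendsto_order.2 ⟨fun a ha => Eventually.of_forall fun n =>
    ha.trans_le (overconvergentTerm_nonneg hν x n), fun a ha => ?_⟩
  filter_upwards [h (a / 2) (by positivity)] with n hn
  linarith

end Terms

theorem exists_forall_overconvergentTerm_le {x : InverseLimitWitt p R}
    (hx : x ∈ overconvergent p ν b) {δ : ℝ} (hδ : 0 < δ) :
    ∃ k, ∀ m, k ≤ m → overconvergentTerm p ν b x m ≤ δ := by
  obtain ⟨k, hk⟩ := eventually_atTop.1 (Tendsto.eventually_lt_const hδ hx)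
  exact ⟨k, fun m hm => (hk m hm).le⟩

theorem overconvergentTerm_le_norm {x : InverseLimitWitt p R} (hx : x ∈ overconvergent p ν b)
    (n : ℕ) : overconvergentTerm p ν b x n ≤ overconvergentNorm p ν b x :=
  le_ciSup (f := overconvergentTerm p ν b x) (Tendsto.bddAbove_range hx) n

theorem isNonarchSeminorm_overconvergentNorm (hν : IsSpectral p ν) (hpR : IsUnit (p : R))
    {S : Subring (InverseLimitWitt p R)} (hS : (S : Set (InverseLimitWitt p R)) =
      overconvergent p ν b) :
    IsNonarchSeminorm (fun x : S => overconvergentNorm p ν b x) where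
  nonneg x := overconvergentNorm_nonneg hν _
  map_zero := by
    simp only [overconvergentNorm, ZeroMemClass.coe_zero, overconvergentTerm_zero hν, ciSup_const]
  add_le_max x y := by
    have hx : (x : InverseLimitWitt p R) ∈ overconvergent p ν b := hS ▸ x.2
    have hy : (y : InverseLimitWitt p R) ∈ overconvergent p ν b := hS ▸ y.2
    exact ciSup_le fun n => (overconvergentTerm_add_le hν hpR _ _ n).trans
      (max_le_max (overconvergentTerm_le_norm hx n) (overconvergentTerm_le_norm hy n))

/-! ### The case `b ≤ 1`: multiplicativity. -/

section SmallRadius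

variable (hν : IsSpectral p ν) (hpR : IsUnit (p : R))
include hν hpR

theorem levelBound_out (hb1 : b ≤ 1) {x : InverseLimitWitt p R} {α : ℝ} (hα : 0 ≤ α) {n : ℕ}
    (h : ∀ m ≤ n, overconvergentTerm p ν b x m ≤ α) :
    LevelBound ν ((p : ℝ) ^ b) n α (x.1 n).out := fun i hi => by
  simpa using coeff_out_le hν hpR le_rfl (growth_le_of_le_one hb1) x hα hi fun m _ hm => h m hm

theorem rpow_le_self (hb1 : b ≤ 1) : (p : ℝ) ^ b ≤ p := by
  have hp1 : (1 : ℝ) ≤ p := by exact_mod_cast hp.out.one_lt.le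
  simpa using Real.rpow_le_rpow_of_exponent_le hp1 hb1

theorem overconvergentTerm_mul_le (hb : 0 < b) (hb1 : b ≤ 1) {x y : InverseLimitWitt p R}
    (hx : x ∈ overconvergent p ν b) (hy : y ∈ overconvergent p ν b) (n : ℕ) :
    overconvergentTerm p ν b (x * y) n ≤
      overconvergentNorm p ν b x * overconvergentNorm p ν b y := by
  have hx0 := overconvergentNorm_nonneg (b := b) hν x
  have hy0 := overconvergentNorm_nonneg (b := b) hν y
  have hQ := one_lt_rpow (p := p) hb
  rw [overconvergentTerm_le_iff hν _ _ (by positivity), levelBound_congr (truncate_out_mul x y n)]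
  exact ((levelBound_out hν hpR hb1 hx0 fun m _ => overconvergentTerm_le_norm hx m).mul hν hpR
    hx0 hy0 hQ.le (rpow_le_self hν hpR hb1)
    (levelBound_out hν hpR hb1 hy0 fun m _ => overconvergentTerm_le_norm hy m)).to_one
    (by positivity) hQ.le

/-- The components of index less than `k`. -/
theorem levelBound_select_lt (hb : 0 < b) (hb1 : b ≤ 1) {x : InverseLimitWitt p R}
    (hx : x ∈ overconvergent p ν b) (k n : ℕ) :
    LevelBound ν 1 n (overconvergentNorm p ν b x * ((p : ℝ) ^ b) ^ k)
      (WittVector.select (fun i => i < k) (x.1 n).out) := by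
  have hx0 := overconvergentNorm_nonneg (b := b) hν x
  have hQ := one_lt_rpow (p := p) hb
  intro i hi
  rw [coeff_select_eq_ite, one_pow, mul_one]
  split_ifs with h
  · refine (levelBound_out hν hpR hb1 hx0
      (fun m _ => overconvergentTerm_le_norm hx m) i hi).trans ?_
    gcongr
    exact hQ.le
  · rw [hν.map_zero, zero_pow (pow_ne_zero _ hp.out.ne_zero)]
    positivity

/-- The components of index at least `k`. -/
theorem levelBound_select_not_lt (hb1 : b ≤ 1) {x : InverseLimitWitt p R} {δ : ℝ} (hδ : 0 ≤ δ)
    {k : ℕ} (h : ∀ m, k ≤ m → overconvergentTerm p ν b x m ≤ δ) (n : ℕ) :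
    LevelBound ν ((p : ℝ) ^ b) n δ (WittVector.select (fun i => ¬ i < k) (x.1 n).out) := by
  intro i hi
  rw [coeff_select_eq_ite]
  split_ifs with h'
  · rw [hν.map_zero, zero_pow (pow_ne_zero _ hp.out.ne_zero)]
    positivity
  · simpa using coeff_out_le hν hpR le_rfl (growth_le_of_le_one hb1) x hδ hi
      fun m hm _ => h m (by omega)

/-- Cut both factors into a head and a tail. The tails are uniformly small in the weighted sense,
and the product of the heads has a bound independent of `n`, which the factor `Q ^ (-n)` sends to
zero. -/
theorem mul_mem_overconvergent (hb : 0 < b) (hb1 : b ≤ 1) {x y : InverseLimitWitt p R}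
    (hx : x ∈ overconvergent p ν b) (hy : y ∈ overconvergent p ν b) :
    x * y ∈ overconvergent p ν b := by
  have hx0 := overconvergentNorm_nonneg (b := b) hν x
  have hy0 := overconvergentNorm_nonneg (b := b) hν y
  have hQ := one_lt_rpow (p := p) hb
  have hQ0 := zero_lt_one.trans hQ
  have hQp := rpow_le_self hν hpR hb1
  refine mem_overconvergent_of_eventually hν fun η hη => ?_
  set α := overconvergentNorm p ν b x
  set β := overconvergentNorm p ν b y
  obtain ⟨δ, hδ, hδα, hδβ⟩ : ∃ δ : ℝ, 0 < δ ∧ α * δ ≤ η ∧ δ * β ≤ η := by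
    refine ⟨η / (α + β + 1), by positivity, ?_, ?_⟩
    · rw [mul_div_assoc', div_le_iff₀ (by positivity)]; nlinarith
    · rw [div_mul_eq_mul_div, div_le_iff₀ (by positivity)]; nlinarith
  obtain ⟨k, hk⟩ := exists_forall_overconvergentTerm_le hx hδ
  obtain ⟨l, hl⟩ := exists_forall_overconvergentTerm_le hy hδ
  have hlim : ∀ᶠ n in atTop, α * ((p : ℝ) ^ b) ^ k * (β * ((p : ℝ) ^ b) ^ l) / η ≤
      ((p : ℝ) ^ b) ^ n := (tendsto_pow_atTop_atTop_of_one_lt hQ).eventually_ge_atTop _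
  filter_upwards [hlim] with n hn
  rw [div_le_iff₀ hη, mul_comm _ η] at hn
  rw [overconvergentTerm_le_iff hν _ _ hη.le, levelBound_congr (truncate_out_mul x y n)]
  set X := (x.1 n).out
  set Y := (y.1 n).out
  have hX : WittVector.select (fun i => i < k) X + WittVector.select (fun i => ¬ i < k) X = X :=
    WittVector.select_add_select_not _ _
  have hY : WittVector.select (fun i => i < l) Y + WittVector.select (fun i => ¬ i < l) Y = Y :=
    WittVector.select_add_select_not _ _
  have bX := levelBound_out hν hpR hb1 hx0 fun m (_ : m ≤ n) => overconvergentTerm_le_norm hx m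
  have bY := levelBound_out hν hpR hb1 hy0 fun m (_ : m ≤ n) => overconvergentTerm_le_norm hy m
  have h1 := levelBound_select_lt hν hpR hb hb1 hx k n
  have h2 := levelBound_select_not_lt hν hpR hb1 hδ.le hk n
  have h3 := levelBound_select_lt hν hpR hb hb1 hy l n
  have h4 := levelBound_select_not_lt hν hpR hb1 hδ.le hl n
  rw [show X * Y = WittVector.select (fun i => i < k) X * WittVector.select (fun i => i < l) Y +
      (X * WittVector.select (fun i => ¬ i < l) Y +
        WittVector.select (fun i => ¬ i < k) X * WittVector.select (fun i => i < l) Y) by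
    linear_combination -X * hY - WittVector.select (fun i => i < l) Y * hX]
  have b3 : LevelBound ν ((p : ℝ) ^ b) n β (WittVector.select (fun i => i < l) Y) := by
    intro i hi
    rw [coeff_select_eq_ite]
    split_ifs with h
    · exact bY i hi
    · rw [hν.map_zero, zero_pow (pow_ne_zero _ hp.out.ne_zero)]
      positivity
  refine LevelBound.add hν hpR (by positivity) le_rfl ?_ ?_
  · exact (h1.mul hν hpR (by positivity) (by positivity) le_rfl
      (by exact_mod_cast hp.out.one_lt.le) h3).mono_const zero_le_one hn
  · refine (LevelBound.add hν hpR hη.le hQ.le ?_ ?_).to_one hη.le hQ.le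
    · exact (bX.mul hν hpR hx0 hδ.le hQ.le hQp h4).mono_const hQ0.le hδα
    · exact (h2.mul hν hpR hδ.le hy0 hQ.le hQp b3).mono_const hQ0.le hδβ

/-- At a high level `N`, some component attains the norm. -/
theorem exists_coeff_eq_norm (hb : 0 < b) (hb1 : b ≤ 1) {x : InverseLimitWitt p R}
    (hx : x ∈ overconvergent p ν b) (hpos : 0 < overconvergentNorm p ν b x) {N : ℕ}
    (hN : ∀ m, N < m → overconvergentTerm p ν b x m ≤ overconvergentNorm p ν b x / 2) :
    ∃ i ≤ N, ν ((x.1 N).out.coeff i) ^ p ^ (N - i) =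
      overconvergentNorm p ν b x * ((p : ℝ) ^ b) ^ i := by
  have hQ := one_lt_rpow (p := p) hb
  have hQ0 := zero_lt_one.trans hQ
  set α := overconvergentNorm p ν b x
  by_contra! hne
  have hlt : ∀ i ≤ N, ν ((x.1 N).out.coeff i) ^ p ^ (N - i) < α * ((p : ℝ) ^ b) ^ i :=
    fun i hi => lt_of_le_of_ne (levelBound_out hν hpR hb1 hpos.le
      (fun m _ => overconvergentTerm_le_norm hx m) i hi) (hne i hi)
  -- If no component attains the norm, finitely many strict inequalities leave room for a smaller
  -- constant `γ`.
  obtain ⟨γ, hγ0, hγα, hγ⟩ : ∃ γ, 0 ≤ γ ∧ γ < α ∧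
      LevelBound ν ((p : ℝ) ^ b) N γ (x.1 N).out := by
    have h : ∀ᶠ γ in 𝓝[<] α, ∀ i ∈ Finset.range (N + 1),
        ν ((x.1 N).out.coeff i) ^ p ^ (N - i) ≤ γ * ((p : ℝ) ^ b) ^ i := by
      rw [Filter.eventually_all_finset]
      intro i hi
      have hc : Tendsto (fun γ : ℝ => γ * ((p : ℝ) ^ b) ^ i) (𝓝[<] α)
          (𝓝 (α * ((p : ℝ) ^ b) ^ i)) :=
        (Continuous.tendsto (by fun_prop) α).mono_left nhdsWithin_le_nhds
      filter_upwards [hc.eventually_const_lt (hlt i (Finset.mem_range_succ_iff.1 hi))] with γ h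
        using h.le
    obtain ⟨γ, h1, h2, h3⟩ := (h.and ((Filter.Eventually.and
      (mem_nhdsWithin_of_mem_nhds (lt_mem_nhds hpos)) self_mem_nhdsWithin))).exists
    exact ⟨γ, le_of_lt h2, h3, fun i hi => h1 i (Finset.mem_range_succ_iff.2 hi)⟩
  -- Frobenius carries the bound with `γ` from level `N` down to all lower levels; the higher terms
  -- are at most `α / 2`, so the supremum would be less than `α`.
  have hle : ∀ m ≤ N, LevelBound ν ((p : ℝ) ^ b) m γ (x.1 m).out := by
    intro m hm
    induction hm using Nat.decreasingInduction with
    | self => exact hγ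
    | of_succ m hm ih =>
      rw [levelBound_congr (truncate_frobenius_out x m)]
      exact ih.frobenius hν hpR hγ0 hQ.le (rpow_le_self hν hpR hb1)
  have hα : α ≤ max γ (α / 2) := ciSup_le fun m => by
    rcases le_or_gt m N with h | h
    · refine le_trans ?_ (le_max_left _ _)
      rw [overconvergentTerm_le_iff hν _ _ hγ0]
      exact (hle m h).to_one hγ0 hQ.le
    · exact (hN m h).trans (le_max_right _ _)
  exact absurd hα (not_le.2 (max_lt hγα (by linarith)))

theorem overconvergentNorm_sq_le (hb : 0 < b) (hb1 : b ≤ 1) {x : InverseLimitWitt p R}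
    (hx : x ∈ overconvergent p ν b) :
    overconvergentNorm p ν b x ^ 2 ≤ overconvergentNorm p ν b (x ^ 2) := by
  have hx0 := overconvergentNorm_nonneg (b := b) hν x
  have hx20 := overconvergentNorm_nonneg (b := b) hν (x ^ 2)
  have hx2 : x ^ 2 ∈ overconvergent p ν b := by
    rw [sq]; exact mul_mem_overconvergent hν hpR hb hb1 hx hx
  have hQ := one_lt_rpow (p := p) hb
  have hQ0 := zero_lt_one.trans hQ
  rcases hx0.eq_or_lt with h0 | hpos
  · rw [← h0]; simpa using hx20
  set α := overconvergentNorm p ν b x with hα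
  obtain ⟨k, hk⟩ := exists_forall_overconvergentTerm_le hx (half_pos hpos)
  -- Take the largest index attaining the norm at level `k + k`, so that all later components are
  -- strictly smaller.
  obtain ⟨i, ⟨hi, hiα⟩, hmax⟩ : ∃ i, (i ≤ k + k ∧ ν ((x.1 (k + k)).out.coeff i) ^ p ^ (k + k - i) =
      α * ((p : ℝ) ^ b) ^ i) ∧ ∀ j, (j ≤ k + k ∧ ν ((x.1 (k + k)).out.coeff j) ^ p ^ (k + k - j) =
      α * ((p : ℝ) ^ b) ^ j) → j ≤ i := by
    obtain ⟨i, hi⟩ := exists_coeff_eq_norm hν hpR hb hb1 hx hpos (N := k + k)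
      fun m hm => hk m (by omega)
    classical
    exact ⟨_, Nat.findGreatest_spec (P := fun i => i ≤ k + k ∧
      ν ((x.1 (k + k)).out.coeff i) ^ p ^ (k + k - i) = α * ((p : ℝ) ^ b) ^ i) hi.1 hi,
      fun j hj => Nat.le_findGreatest hj.1 hj⟩
  -- A component of index beyond `k` is controlled only by terms of index beyond `k`, which are at
  -- most `α / 2`. Hence `i + i` still lies in the range of level `k + k`.
  have hik : i ≤ k := by
    by_contra! hki
    have := coeff_out_le hν hpR le_rfl (growth_le_of_le_one hb1) x (half_pos hpos).le hi
      fun m hm _ => hk m (by omega)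
    rw [hiα, one_mul, mul_le_mul_iff_of_pos_right (by positivity)] at this
    linarith
  by_contra! hlt
  have hbx := levelBound_out hν hpR hb1 hx0
    fun m (_ : m ≤ k + k) => overconvergentTerm_le_norm hx m
  refine hbx.not_sq hν hpR hx20 hpos hQ (rpow_le_self hν hpR hb1) (by omega : i + i ≤ k + k) hiα
    (fun j hj hij => lt_of_le_of_ne (hbx j hj) fun h => ?_) hlt ?_
  · exact absurd (hmax j ⟨hj, h⟩) (by omega)
  · rw [← levelBound_congr (truncate_out_mul x x _), ← sq]
    exact levelBound_out hν hpR hb1 hx20 fun m _ => overconvergentTerm_le_norm hx2 m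

/-- The subring of overconvergent elements for `b ≤ 1`. -/
def overconvergentSubring (hb : 0 < b) (hb1 : b ≤ 1) : Subring (InverseLimitWitt p R) where
  carrier := overconvergent p ν b
  zero_mem' := zero_mem_overconvergent hν
  one_mem' := one_mem_overconvergent hν hb
  add_mem' := add_mem_overconvergent hν hpR
  neg_mem' := neg_mem_overconvergent hν hpR
  mul_mem' := mul_mem_overconvergent hν hpR hb hb1

theorem isPowerMultiplicativeSeminorm_overconvergentNorm (hb : 0 < b) (hb1 : b ≤ 1)
    {S : Subring (InverseLimitWitt p R)} (hS : (S : Set (InverseLimitWitt p R)) =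
      overconvergent p ν b) :
    IsPowerMultiplicativeSeminorm (fun x : S => overconvergentNorm p ν b x) where
  toIsNonarchSeminorm := isNonarchSeminorm_overconvergentNorm hν hpR hS
  mul_le x y := by
    have hx : (x : InverseLimitWitt p R) ∈ overconvergent p ν b := hS ▸ x.2
    have hy : (y : InverseLimitWitt p R) ∈ overconvergent p ν b := hS ▸ y.2
    exact ciSup_le fun n => overconvergentTerm_mul_le hν hpR hb hb1 hx hy n
  sq_le x := by
    have hx : (x : InverseLimitWitt p R) ∈ overconvergent p ν b := hS ▸ x.2
    exact overconvergentNorm_sq_le hν hpR hb hb1 hx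

end SmallRadius

end OverconvergentWitt

/-! ### The case `b > 1`: reduction from `b` to `b / p` by shifting. -/

namespace OverconvergentWitt

open Filter Topology

universe u

variable {p : ℕ} [hp : Fact p.Prime] {R : Type u} [CommRing R]

variable {ν : R → ℝ} {b : ℝ}

variable (p R) in
/-- The shift on the inverse limit, which forgets the ghost component of index `0`: its level `n`
is the truncation of level `n + 1`. -/
noncomputable def shift : InverseLimitWitt p R →+* InverseLimitWitt p R where
  toFun x := ⟨fun n => TruncatedWittVector.truncate (Nat.le_succ (n + 1)) (x.1 (n + 1)), fun n => by
    -- Lifting level `n + 2` to a full Witt vector makes both sides truncations of its Frobenius.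
    obtain ⟨X, hX⟩ : ∃ X, WittVector.truncate (n + 3) X = x.1 (n + 2) := ⟨_, truncate_out _⟩
    have h : x.1 (n + 1) = WittVector.truncate (n + 2) (WittVector.frobenius X) := by
      rw [← truncFrobenius_truncate, hX, x.2 (n + 1)]
    show truncFrobenius p R (n + 1) (TruncatedWittVector.truncate _ (x.1 (n + 2))) =
      TruncatedWittVector.truncate _ (x.1 (n + 1))
    rw [h, ← hX, TruncatedWittVector.truncate_wittVector_truncate,
      TruncatedWittVector.truncate_wittVector_truncate, truncFrobenius_truncate]⟩
  map_zero' := by ext n : 2; exact map_zero _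
  map_one' := by ext n : 2; exact map_one _
  map_add' x y := by ext n : 2; exact map_add _ _ _
  map_mul' x y := by ext n : 2; exact map_mul _ _ _

theorem coeff_out_shift (x : InverseLimitWitt p R) {i n : ℕ} (hi : i ≤ n) :
    ((shift p R x).1 n).out.coeff i = (x.1 (n + 1)).out.coeff i := by
  have h1 := TruncatedWittVector.coeff_out ((shift p R x).1 n) ⟨i, by omega⟩
  have h2 := TruncatedWittVector.coeff_out (x.1 (n + 1)) ⟨i, by omega⟩
  have h3 := TruncatedWittVector.coeff_truncate (Nat.le_succ (n + 1)) ⟨i, by omega⟩ (x.1 (n + 1))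
  exact h1.trans (h3.trans h2.symm)

variable (p R) in
/-- The ghost component of index `0`. -/
noncomputable def ghostZero : InverseLimitWitt p R →+* R where
  toFun x := (x.1 0).out.coeff 0
  map_zero' := by
    have := TruncatedWittVector.coeff_out (0 : TruncatedWittVector p (0 + 1) R) 0
    exact this.trans (TruncatedWittVector.coeff_zero p (0 + 1) R 0)
  map_one' := by
    have h := TruncatedWittVector.coeff_out (1 : TruncatedWittVector p (0 + 1) R) 0
    refine h.trans ?_
    rw [← map_one (WittVector.truncate (0 + 1)), WittVector.coeff_truncate]
    exact WittVector.one_coeff_zero p R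
  map_add' x y := by
    have h := congrArg (TruncatedWittVector.coeff 0) (truncate_out_add x y 0)
    rw [WittVector.coeff_truncate, WittVector.coeff_truncate] at h
    exact h.trans (WittVector.add_coeff_zero _ _)
  map_mul' x y := by
    have h := congrArg (TruncatedWittVector.coeff 0) (truncate_out_mul x y 0)
    rw [WittVector.coeff_truncate, WittVector.coeff_truncate] at h
    exact h.trans (WittVector.mul_coeff_zero _ _)

/-- Frobenius lowers the index of ghost components by one, so the top ghost component is the same at
every level. -/
theorem ghostComponent_out (x : InverseLimitWitt p R) (n : ℕ) :
    ∑ i ∈ Finset.range (n + 1), (p : R) ^ i * (x.1 n).out.coeff i ^ p ^ (n - i) =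
      ghostZero p R x := by
  have key : ∀ (n : ℕ) (y : WittVector p R), WittVector.ghostComponent n y =
      ∑ i ∈ Finset.range (n + 1), (p : R) ^ i * y.coeff i ^ p ^ (n - i) := fun n y => by
    simp [WittVector.ghostComponent_apply, wittPolynomial_eq_sum_C_mul_X_pow]
  induction n with
  | zero => simp [ghostZero]
  | succ n ih =>
    rw [← key, ← WittVector.ghostComponent_frobenius, key, ← ih]
    refine Finset.sum_congr rfl fun i hi => ?_
    rw [coeff_frobenius_out x (Finset.mem_range_succ_iff.1 hi)]

theorem IsSpectral.map_p_pow_mul (hν : IsSpectral p ν) (n : ℕ) (x : R) :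
    ν ((p : R) ^ n * x) = ((p : ℝ)⁻¹) ^ n * ν x := by
  induction n with
  | zero => simp
  | succ n ih => rw [pow_succ', mul_assoc, hν.map_p_mul, ih, pow_succ', mul_assoc]

theorem rpow_div_pow : ((p : ℝ) ^ (b / p)) ^ p = (p : ℝ) ^ b := by
  have hp0 : (p : ℝ) ≠ 0 := by exact_mod_cast hp.out.ne_zero
  rw [← Real.rpow_natCast, ← Real.rpow_mul (Nat.cast_nonneg p), div_mul_cancel₀ _ hp0]

section Shift

variable (hν : IsSpectral p ν)
include hν

/-- The same components appear on both sides, with exponents `p ^ (n - i)` and `p ^ (n + 1 - i)`;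
the p-th power and the radius `b / p` compensate for this, and `p ^ b` comes from the index `n + 1`.
-/
theorem overconvergentTerm_shift_pow_le (x : InverseLimitWitt p R) (n : ℕ) :
    overconvergentTerm p ν (b / p) (shift p R x) n ^ p ≤
      (p : ℝ) ^ b * overconvergentTerm p ν b x (n + 1) := by
  have hp0 : (0 : ℝ) < p := by exact_mod_cast hp.out.pos
  have h0 := overconvergentTerm_nonneg (b := b) hν x (n + 1)
  have h := (overconvergentTerm_le_iff hν x (n + 1) h0).1 le_rfl
  obtain ⟨s, hs, hs'⟩ := exists_pow_eq (p := p) 1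
    (by positivity : 0 ≤ (p : ℝ) ^ b * overconvergentTerm p ν b x (n + 1))
  rw [pow_one] at hs'
  rw [← hs']
  refine pow_le_pow_left₀ (overconvergentTerm_nonneg hν _ _) ?_ _
  rw [overconvergentTerm_le_iff hν _ _ hs]
  intro i hi
  have h1 := h i (by omega)
  rw [one_pow, mul_one] at h1 ⊢
  rw [coeff_out_shift x hi]
  refine le_of_pow_le_pow_left₀ hp.out.ne_zero (by positivity) ?_
  rw [← pow_mul, ← pow_succ, show n - i + 1 = n + 1 - i by omega, mul_pow, hs', ← pow_mul,
    mul_comm n, pow_mul, rpow_div_pow]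
  exact h1.trans_eq (by ring)

theorem nu_ghostZero_le (x : InverseLimitWitt p R) :
    ν (ghostZero p R x) ≤ overconvergentTerm p ν b x 0 := by
  simpa [ghostZero] using
    (overconvergentTerm_le_iff hν x 0 (overconvergentTerm_nonneg (b := b) hν x 0)).1 le_rfl 0 le_rfl

theorem overconvergentTerm_zero_le (x : InverseLimitWitt p R) :
    overconvergentTerm p ν b x 0 ≤ ν (ghostZero p R x) := by
  rw [overconvergentTerm_le_iff hν x 0 (hν.nonneg _)]
  intro i hi
  obtain rfl : i = 0 := by omega
  simp [ghostZero]

/-- The components of index at most `n` are those of the shift. The last one satisfies `p ^ (n + 1)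
* x_{n+1} = w - ∑ p ^ i * x_i ^ (p ^ (n + 1 - i))`, and dividing by `p ^ (n + 1)` costs exactly the
powers of `p` in the hypotheses. -/
theorem overconvergentTerm_succ_le (x : InverseLimitWitt p R) (n : ℕ) {G : ℝ} (hG : 0 ≤ G)
    (h0 : ν (ghostZero p R x) * (p : ℝ) ^ (n + 1) ≤ G * ((p : ℝ) ^ b) ^ (n + 1))
    (h : ∀ i ≤ n, (ν (((shift p R x).1 n).out.coeff i) ^ p ^ (n - i)) ^ p * (p : ℝ) ^ (n + 1 - i) ≤
      G * ((p : ℝ) ^ b) ^ (n + 1)) :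
    overconvergentTerm p ν b x (n + 1) ≤ G := by
  have hp1 : (1 : ℝ) ≤ p := by exact_mod_cast hp.out.one_lt.le
  have hp0 : (0 : ℝ) < p := zero_lt_one.trans_le hp1
  rw [overconvergentTerm_le_iff hν _ _ hG]
  have e : ∀ i ≤ n, (ν (((shift p R x).1 n).out.coeff i) ^ p ^ (n - i)) ^ p =
      ν ((x.1 (n + 1)).out.coeff i) ^ p ^ (n + 1 - i) := fun i hi => by
    rw [coeff_out_shift x hi, ← pow_mul, ← pow_succ, show n - i + 1 = n + 1 - i by omega]
  intro i hi
  rw [one_pow, mul_one]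
  rcases Nat.lt_or_ge n i with hin | hin
  · obtain rfl : i = n + 1 := by omega
    have hg := ghostComponent_out x (n + 1)
    rw [Finset.sum_range_succ, Nat.sub_self, pow_zero, pow_one, ← eq_sub_iff_add_eq'] at hg
    rw [Nat.sub_self, pow_zero, pow_one]
    have hle : ν ((p : R) ^ (n + 1) * (x.1 (n + 1)).out.coeff (n + 1)) ≤
        ((p : ℝ)⁻¹) ^ (n + 1) * (G * ((p : ℝ) ^ b) ^ (n + 1)) := by
      rw [hg]
      refine (hν.sub_le_max _ _).trans (max_le ?_ (hν.sum_le _ _ (by positivity) fun i hi => ?_))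
      · rw [inv_pow, le_inv_mul_iff₀ (by positivity), mul_comm]
        exact h0
      · have hi' := Finset.mem_range_succ_iff.1 hi
        have hh := h i hi'
        rw [e i hi'] at hh
        have hp' : (p : ℝ) ^ (n + 1) = p ^ i * p ^ (n + 1 - i) := by
          rw [← pow_add, show i + (n + 1 - i) = n + 1 by omega]
        rw [hν.map_p_pow_mul, inv_pow, inv_pow, inv_mul_le_iff₀ (by positivity), hp', mul_inv,
          mul_assoc, mul_inv_cancel_left₀ (by positivity), le_inv_mul_iff₀ (by positivity),
          mul_comm]
        exact (mul_le_mul_of_nonneg_right (hν.pow_le _ _) (by positivity)).trans hh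
    rw [hν.map_p_pow_mul] at hle
    exact le_of_mul_le_mul_left hle (by positivity)
  · rw [← e i hin]
    exact (le_mul_of_one_le_right (pow_nonneg (pow_nonneg (hν.nonneg _) _) _)
      (one_le_pow₀ hp1)).trans (h i hin)

variable (hpR : IsUnit (p : R))
include hpR

theorem overconvergentNorm_le_shift (hb1 : 1 < b) {C : ℝ} (hC1 : 1 ≤ C)
    (hC : ∀ k : ℕ, ((p : ℝ) ^ (b / p)) ^ (k + 1) ≤ C * p ^ p ^ k) {x : InverseLimitWitt p R}
    (hx : shift p R x ∈ overconvergent p ν (b / p)) :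
    overconvergentNorm p ν b x ≤ max (ν (ghostZero p R x))
      ((C * overconvergentNorm p ν (b / p) (shift p R x)) ^ p) := by
  have hp1 : (1 : ℝ) < p := by exact_mod_cast hp.out.one_lt
  have hp0 : (0 : ℝ) < p := zero_lt_one.trans hp1
  have hpQ : (p : ℝ) ≤ (p : ℝ) ^ b := by
    simpa using Real.rpow_le_rpow_of_exponent_le hp1.le hb1.le
  have hn := overconvergentNorm_nonneg (b := b / p) hν (shift p R x)
  set α := overconvergentNorm p ν (b / p) (shift p R x)
  have hG : 0 ≤ max (ν (ghostZero p R x)) ((C * α) ^ p) := (hν.nonneg _).trans (le_max_left _ _)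
  refine ciSup_le fun n => ?_
  cases n with
  | zero => exact (overconvergentTerm_zero_le hν x).trans (le_max_left _ _)
  | succ n =>
    refine overconvergentTerm_succ_le hν x n hG ?_ fun i hi => ?_
    · gcongr
      exact le_max_left _ _
    · have h := coeff_out_le hν hpR hC1 hC (shift p R x) hn hi
        fun m _ _ => overconvergentTerm_le_norm hx m
      calc _ ≤ (C * α * ((p : ℝ) ^ (b / p)) ^ i) ^ p * (p : ℝ) ^ (n + 1 - i) := by
            gcongr
            exact pow_nonneg (hν.nonneg _) _
        _ = (C * α) ^ p * (((p : ℝ) ^ b) ^ i * (p : ℝ) ^ (n + 1 - i)) := by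
            rw [mul_pow, ← pow_mul, mul_comm i, pow_mul, rpow_div_pow, mul_assoc]
        _ ≤ (C * α) ^ p * (((p : ℝ) ^ b) ^ i * ((p : ℝ) ^ b) ^ (n + 1 - i)) := by gcongr
        _ = (C * α) ^ p * ((p : ℝ) ^ b) ^ (n + 1) := by
            rw [← pow_add, show i + (n + 1 - i) = n + 1 by omega]
        _ ≤ _ := by
            gcongr
            exact le_max_right _ _

/-- From the shift to `x`, strictness of `p < p ^ b` makes the ghost component and the finitely many
low indices negligible at high level. -/
theorem shift_mem_overconvergent_iff (hb1 : 1 < b) {x : InverseLimitWitt p R} :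
    shift p R x ∈ overconvergent p ν (b / p) ↔ x ∈ overconvergent p ν b := by
  have hp1 : (1 : ℝ) < p := by exact_mod_cast hp.out.one_lt
  have hp0 : (0 : ℝ) < p := zero_lt_one.trans hp1
  have hpQ : (p : ℝ) < (p : ℝ) ^ b := by
    simpa using Real.rpow_lt_rpow_of_exponent_lt hp1 hb1
  have hQ0 : 0 < (p : ℝ) ^ b := by positivity
  refine ⟨fun hx => ?_, fun hx => ?_⟩
  · obtain ⟨C, hC1, hC⟩ := exists_growth_constant p (b / p)
    have hn := overconvergentNorm_nonneg (b := b / p) hν (shift p R x)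
    set α := overconvergentNorm p ν (b / p) (shift p R x)
    refine mem_overconvergent_of_eventually hν fun η hη => ?_
    obtain ⟨δ, hδ, hδη⟩ := exists_pow_eq (p := p) 1 hη.le
    rw [pow_one] at hδη
    have hδ0 : 0 < δ := by
      refine lt_of_le_of_ne hδ fun h => ?_
      rw [← h, zero_pow hp.out.ne_zero] at hδη
      exact hη.ne hδη
    obtain ⟨k, hk⟩ := exists_forall_overconvergentTerm_le hx (div_pos hδ0 (by positivity : 0 < C))
    have hlim : ∀ D : ℝ, ∀ᶠ n : ℕ in atTop,
        D * (p : ℝ) ^ (n + 1) ≤ η * ((p : ℝ) ^ b) ^ (n + 1) := fun D => by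
      have h := (tendsto_pow_atTop_atTop_of_one_lt ((one_lt_div hp0).2 hpQ)).comp
        (tendsto_add_atTop_nat 1)
      filter_upwards [h.eventually_ge_atTop (D / η)] with n hn
      rw [Function.comp_apply, div_pow, div_le_div_iff₀ hη (by positivity)] at hn
      linarith
    have hev : ∀ᶠ n : ℕ in atTop, overconvergentTerm p ν b x (n + 1) ≤ η := by
      filter_upwards [hlim (ν (ghostZero p R x)), hlim ((C * α) ^ p * ((p : ℝ) ^ b) ^ k)]
        with n h1 h2
      refine overconvergentTerm_succ_le hν x n hη.le h1 fun i hi => ?_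
      have bd : ∀ a : ℝ, 0 ≤ a → (∀ m, i ≤ m → m ≤ n →
          overconvergentTerm p ν (b / p) (shift p R x) m ≤ a) →
          (ν (((shift p R x).1 n).out.coeff i) ^ p ^ (n - i)) ^ p * (p : ℝ) ^ (n + 1 - i) ≤
            (C * a) ^ p * ((p : ℝ) ^ b) ^ i * (p : ℝ) ^ (n + 1 - i) := fun a ha h => by
        have h := coeff_out_le hν hpR hC1 hC (shift p R x) ha hi h
        calc _ ≤ (C * a * ((p : ℝ) ^ (b / p)) ^ i) ^ p * (p : ℝ) ^ (n + 1 - i) := by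
              gcongr
              exact pow_nonneg (hν.nonneg _) _
          _ = _ := by rw [mul_pow _ _ p, ← pow_mul _ i, mul_comm i, pow_mul _ p, rpow_div_pow]
      -- Low indices use the full norm and the growth of `(p ^ b / p) ^ n`; for `i ≥ k` only terms
      -- bounded by `δ / C` enter.
      rcases Nat.lt_or_ge i k with hik | hik
      · refine (bd α hn fun m _ _ => overconvergentTerm_le_norm hx m).trans (le_trans ?_ h2)
        gcongr
        · exact hp1.le.trans hpQ.le
        · exact hp1.le
        · omega
      · refine (bd _ (by positivity) fun m hm _ => hk m (by omega)).trans ?_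
        rw [mul_div_cancel₀ _ (by positivity), hδη]
        calc η * ((p : ℝ) ^ b) ^ i * (p : ℝ) ^ (n + 1 - i) ≤
              η * ((p : ℝ) ^ b) ^ i * ((p : ℝ) ^ b) ^ (n + 1 - i) := by gcongr
          _ = _ := by rw [mul_assoc, ← pow_add, show i + (n + 1 - i) = n + 1 by omega]
    exact (eventually_atTop.1 hev).elim fun N hN => eventually_atTop.2 ⟨N + 1, fun n hn => by
      obtain ⟨m, rfl⟩ : ∃ m, n = m + 1 := ⟨n - 1, by omega⟩
      exact hN m (by omega)⟩
  · refine mem_overconvergent_of_eventually hν fun η hη => ?_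
    have h := (tendsto_add_atTop_iff_nat 1).2 hx
    filter_upwards [Tendsto.eventually_lt_const
      (by positivity : 0 < η ^ p / (p : ℝ) ^ b) h] with n hn
    refine le_of_pow_le_pow_left₀ hp.out.ne_zero hη.le
      ((overconvergentTerm_shift_pow_le hν x n).trans ?_)
    rw [lt_div_iff₀ hQ0] at hn
    linarith

theorem overconvergentNorm_shift_pow_le {x : InverseLimitWitt p R}
    (hx : x ∈ overconvergent p ν b) :
    overconvergentNorm p ν (b / p) (shift p R x) ^ p ≤
      (p : ℝ) ^ b * overconvergentNorm p ν b x := by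
  have hp0 : (0 : ℝ) < p := by exact_mod_cast hp.out.pos
  have h0 := overconvergentNorm_nonneg (b := b) hν x
  obtain ⟨s, hs, hs'⟩ := exists_pow_eq (p := p) 1
    (by positivity : 0 ≤ (p : ℝ) ^ b * overconvergentNorm p ν b x)
  rw [pow_one] at hs'
  rw [← hs']
  refine pow_le_pow_left₀ (overconvergentNorm_nonneg hν _) (ciSup_le fun n => ?_) _
  refine le_of_pow_le_pow_left₀ hp.out.ne_zero hs
    ((overconvergentTerm_shift_pow_le hν x n).trans ?_)
  rw [hs']
  gcongr
  exact overconvergentTerm_le_norm hx _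

end Shift

/-- Power-multiplicative seminorms are preserved by `(f, g) ↦ max (ν ∘ f) (g ^ p)`. -/
theorem IsPowerMultiplicativeSeminorm.max_pow {T T' : Type*} [CommRing T] [CommRing T']
    (hν : IsSpectral p ν) {g : T' → ℝ} (hg : IsPowerMultiplicativeSeminorm g) (φ : T →+* R)
    (ψ : T →+* T') :
    IsPowerMultiplicativeSeminorm fun x => max (ν (φ x)) (g (ψ x) ^ p) where
  nonneg x := (hν.nonneg _).trans (le_max_left _ _)
  map_zero := by
    simp only [_root_.map_zero, hν.map_zero, hg.map_zero, zero_pow hp.out.ne_zero, max_self]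
  add_le_max x y := by
    simp only [map_add]
    refine max_le ((hν.add_le_max _ _).trans (max_le_max (le_max_left _ _) (le_max_left _ _))) ?_
    refine (pow_le_pow_left₀ (hg.nonneg _) (hg.add_le_max _ _) p).trans ?_
    rcases le_total (g (ψ x)) (g (ψ y)) with h | h
    · rw [max_eq_right h]; exact (le_max_right _ _).trans (le_max_right _ _)
    · rw [max_eq_left h]; exact (le_max_right _ _).trans (le_max_left _ _)
  mul_le x y := by
    have h0 : ∀ x, 0 ≤ g (ψ x) ^ p := fun x => pow_nonneg (hg.nonneg _) _
    simp only [_root_.map_mul]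
    refine max_le ?_ ?_
    · exact (hν.mul_le _ _).trans (mul_le_mul (le_max_left _ _) (le_max_left _ _) (hν.nonneg _)
        ((h0 x).trans (le_max_right _ _)))
    · refine (pow_le_pow_left₀ (hg.nonneg _) (hg.mul_le _ _) p).trans ?_
      rw [mul_pow]
      exact mul_le_mul (le_max_right _ _) (le_max_right _ _) (h0 y)
        ((h0 x).trans (le_max_right _ _))
  sq_le x := by
    simp only [_root_.map_pow]
    rcases le_total (ν (φ x)) (g (ψ x) ^ p) with h | h
    · rw [max_eq_right h]
      refine le_trans ?_ (le_max_right _ _)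
      rw [← pow_mul, mul_comm p 2, pow_mul]
      exact pow_le_pow_left₀ (pow_nonneg (hg.nonneg _) _) (hg.sq_le _) p
    · rw [max_eq_left h, ← hν.map_pow _ _ two_pos]
      exact le_max_left _ _

/-- Induction on `k` replaces `b` by `b / p`. The subring is pulled back along `shift`, so closure
under multiplication for `b > 1` comes for free from the base case. -/
theorem exists_subring_overconvergent (hν : IsSpectral p ν) (hpR : IsUnit (p : R)) (k : ℕ)
    (hb : 0 < b) (hbk : b ≤ (p : ℝ) ^ k) :
    ∃ S : Subring (InverseLimitWitt p R),
      (S : Set (InverseLimitWitt p R)) = overconvergent p ν b ∧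
      ∃ g : S → ℝ, IsPowerMultiplicativeSeminorm g ∧
        MetricallyEquivalent (fun x : S => overconvergentNorm p ν b x) g := by
  have hp0 : (0 : ℝ) < p := by exact_mod_cast hp.out.pos
  induction k generalizing b with
  | zero =>
    rw [pow_zero] at hbk
    exact ⟨overconvergentSubring hν hpR hb hbk, rfl, _,
      isPowerMultiplicativeSeminorm_overconvergentNorm hν hpR hb hbk rfl,
      1, 1, one_pos, one_pos, fun x => by simp⟩
  | succ k ih =>
    rcases le_or_gt b 1 with hb1 | hb1
    · exact ih hb (hb1.trans (one_le_pow₀ (by exact_mod_cast hp.out.one_lt.le)))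
    obtain ⟨S, hS, g, hg, c₁, c₂, hc₁, hc₂, hgc⟩ := ih (b := b / p) (by positivity)
      (by rw [div_le_iff₀ hp0, ← pow_succ]; exact hbk)
    have hmem : ∀ x, x ∈ S.comap (shift p R) ↔ x ∈ overconvergent p ν b := fun x => by
      rw [Subring.mem_comap, ← SetLike.mem_coe, hS]
      exact shift_mem_overconvergent_iff hν hpR hb1
    obtain ⟨C, hC1, hC⟩ := exists_growth_constant p (b / p)
    refine ⟨S.comap (shift p R), Set.ext hmem, _,
      hg.max_pow hν ((ghostZero p R).comp (S.comap (shift p R)).subtype)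
      (((shift p R).comp (S.comap (shift p R)).subtype).codRestrict S fun x => x.2),
      -- The summands `1` account for the ghost component; the others raise the inductive constants
      -- to the p-th power.
      1 + (C * c₁) ^ p, 1 + c₂ ^ p * (p : ℝ) ^ b, by positivity, by positivity, fun x => ?_⟩
    have hx := (hmem x).1 x.2
    have hx0 := overconvergentNorm_nonneg (b := b) hν x
    have hs0 := overconvergentNorm_nonneg (b := b / p) hν (shift p R x)
    obtain ⟨h1, h2⟩ := hgc ⟨shift p R x, x.2⟩
    have hg0 := hg.nonneg ⟨shift p R x, x.2⟩
    have hw0 := hν.nonneg (ghostZero p R x)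
    show _ ≤ _ * max (ν (ghostZero p R x)) (g ⟨shift p R x, x.2⟩ ^ p) ∧
      max (ν (ghostZero p R x)) (g ⟨shift p R x, x.2⟩ ^ p) ≤ _
    set G := g ⟨shift p R x, x.2⟩
    constructor
    · have hM : 0 ≤ max (ν (ghostZero p R x)) (G ^ p) := hw0.trans (le_max_left _ _)
      refine (overconvergentNorm_le_shift hν hpR hb1 hC1 hC (by exact hS ▸ x.2)).trans (max_le ?_ ?_)
      · refine (le_max_left _ _).trans (le_mul_of_one_le_left hM ?_)
        have : 0 ≤ (C * c₁) ^ p := by positivity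
        linarith
      · calc _ ≤ (C * (c₁ * G)) ^ p := by gcongr
          _ = (C * c₁) ^ p * G ^ p := by rw [← mul_assoc, mul_pow]
          _ ≤ _ := by
            gcongr
            · linarith
            · exact le_max_right _ _
    · refine max_le ?_ ?_
      · refine ((nu_ghostZero_le hν _).trans (overconvergentTerm_le_norm hx 0)).trans
          (le_mul_of_one_le_left hx0 ?_)
        have : 0 ≤ c₂ ^ p * (p : ℝ) ^ b := by positivity
        linarith
      · calc G ^ p ≤ (c₂ * overconvergentNorm p ν (b / p) (shift p R x)) ^ p := by
              gcongr
          _ ≤ c₂ ^ p * ((p : ℝ) ^ b * overconvergentNorm p ν b x) := by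
              rw [mul_pow]
              gcongr
              exact overconvergentNorm_shift_pow_le hν hpR hx
          _ ≤ _ := by rw [add_mul, mul_assoc]; linarith

end OverconvergentWitt

theorem mainTheorem7 (p : ℕ) [Fact p.Prime] (A : Type*) [CommRing A]
    (hA : OverconvergentWitt.IsPNormal p A) (b : ℝ) (hb : 0 < b) :
    ∃ S : Subring (OverconvergentWitt.InverseLimitWitt p (Localization.Away (p : A))),
      (S : Set (OverconvergentWitt.InverseLimitWitt p (Localization.Away (p : A)))) =
        OverconvergentWitt.overconvergent p (OverconvergentWitt.padicSeminorm p A) b ∧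
      OverconvergentWitt.IsNonarchSeminorm (fun x : S =>
        OverconvergentWitt.overconvergentNorm p (OverconvergentWitt.padicSeminorm p A) b x) ∧
      (b ≤ 1 → OverconvergentWitt.IsPowerMultiplicativeSeminorm (fun x : S =>
        OverconvergentWitt.overconvergentNorm p (OverconvergentWitt.padicSeminorm p A) b x)) ∧
      (1 < b → ∃ g : S → ℝ, OverconvergentWitt.IsPowerMultiplicativeSeminorm g ∧
        OverconvergentWitt.MetricallyEquivalent (fun x : S =>
          OverconvergentWitt.overconvergentNorm p (OverconvergentWitt.padicSeminorm p A) b x) g) := by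
  have hν := OverconvergentWitt.isSpectral_padicSeminorm hA
  have hpR : IsUnit (p : Localization.Away (p : A)) :=
    OverconvergentWitt.coe_pUnit (p := p) (A := A) ▸ (OverconvergentWitt.pUnit p A).isUnit
  have hp1 : (1 : ℝ) < p := by exact_mod_cast (Fact.out : p.Prime).one_lt
  obtain ⟨k, hk⟩ := pow_unbounded_of_one_lt b hp1
  -- One subring serves both ranges of `b`, since its carrier is prescribed.
  obtain ⟨S, hS, g, hg, hgS⟩ :=
    OverconvergentWitt.exists_subring_overconvergent hν hpR k hb hk.le
  exact ⟨S, hS, OverconvergentWitt.isNonarchSeminorm_overconvergentNorm hν hpR hS,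
    fun hb1 => OverconvergentWitt.isPowerMultiplicativeSeminorm_overconvergentNorm hν hpR hb hb1 hS,
    fun _ => ⟨g, hg, hgS⟩⟩
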